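/- A \emph{factor graph} with $N$ variables and $M$ constraints (for 3SAT) is a bipartite graph between variables and constraints in which each constraint is adjacent to three distinct variables; its \emph{instances} are the $2^{3M}$ 3CNF formulas obtained by choosing a polarity for each occurrence of a variable in a constraint. A \emph{uniform family of factor graphs} assigns to all integers $n>0$ and $0<m\le 2^3\binom n3$ a factor graph $G_{n,m}$ with $N(n,m)$ variables and $M(n,m)$ constraints, where $N$ and $M$ are bounded below by $n$ and above by a polynomial in $n+m$, such that $G_{n,m}$ can be computed from $n,m$ in time polynomial in $n+m$. A class of 3SAT instances can be solved in \emph{SUBEXP/poly} if, for some $\epsilon>0$, there is an algorithm which solves every instance of the class with $N$ variables and $M$ clauses in time $2^{O(N^{1-\epsilon})}$, given an advice string of length polynomial in $N+M$. For the instances on a family, the advice depends only on the index $(n,m)$ of the factor graph; for the class of all instances it depends only on the numbers of variables and clauses. \textbf{Theorem.} There are subexp-universal factor graphs for 3SAT. That is, there is a uniform family of factor graphs $(G_{n,m})$ such that, if the 3SAT instances whose factor graph belongs to the family can be solved in SUBEXP/poly, then all 3SAT instances (3CNF formulas with $n>0$ variables and $0<m\le(2n)^3$ clauses, each a disjunction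 of three literals on not necessarily distinct variables) can be solved in SUBEXP/poly. The same family has this property both when ``solve'' means to decide satisfiability and when it means to find a satisfying assignment or report that there is none. -/

import Mathlib

namespace UFG

/-! The machine model: WHILE programs over binary trees, with a unit-cost step count.
A run of `t` steps allocates at most `t` tree nodes (trees are shared, never copied or compared),
so that this model and Turing machines simulate each other with polynomial overhead. -/

/-- Data values: binary trees. -/
inductive Dat : Type
  | nil : Dat
  | cons : Dat → Dat → Dat

/-- Left subtree (`nil` on `nil`). -/
def Dat.hd : Dat → Dat
  | .nil => .nil
  | .cons a _ => a

/-- Right subtree (`nil` on `nil`). -/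
def Dat.tl : Dat → Dat
  | .nil => .nil
  | .cons _ b => b

/-- Unary numerals. -/
def Dat.ofNat : ℕ → Dat
  | 0 => .nil
  | n + 1 => .cons .nil (Dat.ofNat n)

/-- Truth values; as in all tests of programs, `nil` is false. -/
def Dat.ofBool : Bool → Dat
  | false => .nil
  | true => .cons .nil .nil

/-- Lists. -/
def Dat.ofList : List Dat → Dat
  | [] => .nil
  | a :: l => .cons a (Dat.ofList l)

/-- A store gives the value of each program variable. -/
abbrev Store : Type := ℕ → Dat

/-- Expressions. -/
inductive Expr : Type
  | var : ℕ → Expr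
  | nil : Expr
  | cons : Expr → Expr → Expr
  | hd : Expr → Expr
  | tl : Expr → Expr

/-- Value of an expression. -/
def Expr.eval (s : Store) : Expr → Dat
  | .var i => s i
  | .nil => .nil
  | .cons a b => .cons (a.eval s) (b.eval s)
  | .hd a => (a.eval s).hd
  | .tl a => (a.eval s).tl

/-- Cost of evaluating an expression: its number of nodes. -/
def Expr.cost : Expr → ℕ
  | .var _ => 1
  | .nil => 1
  | .cons a b => a.cost + b.cost + 1
  | .hd a => a.cost + 1
  | .tl a => a.cost + 1

/-- Programs. -/
inductive Prog : Type
  | skip : Prog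
  | assign : ℕ → Expr → Prog
  | seq : Prog → Prog → Prog
  | cond : Expr → Prog → Prog → Prog
  | loop : Expr → Prog → Prog

/-- `Exec p s s' t`: started in the store `s`, the program `p` halts in the store `s'` after
exactly `t` steps. -/
inductive Exec : Prog → Store → Store → ℕ → Prop
  | skip (s : Store) : Exec .skip s s 1
  | assign (s : Store) (i : ℕ) (e : Expr) :
      Exec (.assign i e) s (Function.update s i (e.eval s)) (e.cost + 1)
  | seq {p q : Prog} {s s' s'' : Store} {t t' : ℕ} :
      Exec p s s' t → Exec q s' s'' t' → Exec (.seq p q) s s'' (t + t')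
  | cond_true {e : Expr} {p q : Prog} {s s' : Store} {t : ℕ} :
      e.eval s ≠ .nil → Exec p s s' t → Exec (.cond e p q) s s' (e.cost + 1 + t)
  | cond_false {e : Expr} {p q : Prog} {s s' : Store} {t : ℕ} :
      e.eval s = .nil → Exec q s s' t → Exec (.cond e p q) s s' (e.cost + 1 + t)
  | loop_true {e : Expr} {p : Prog} {s s' s'' : Store} {t t' : ℕ} :
      e.eval s ≠ .nil → Exec p s s' t → Exec (.loop e p) s' s'' t' →
        Exec (.loop e p) s s'' (e.cost + 1 + t + t')
  | loop_false {e : Expr} {p : Prog} {s : Store} :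
      e.eval s = .nil → Exec (.loop e p) s s (e.cost + 1)

/-- `Computes p x y t`: on input `x` the program `p` halts with output `y` after exactly `t` steps.
Input and output are in variable `0`; all other variables are initially `nil`. -/
def Computes (p : Prog) (x y : Dat) (t : ℕ) : Prop :=
  ∃ s' : Store, Exec p (Function.update (fun _ => Dat.nil) 0 x) s' t ∧ s' 0 = y

/-! 3SAT. -/

/-- A 3CNF formula: each clause is a disjunction of three literals, a literal being a variable
with a polarity. The variables of a clause need not be distinct, so that clauses with
fewer than three literals are covered. -/
structure Formula where
  numVars : ℕ
  numClauses : ℕ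
  lit : Fin numClauses → Fin 3 → Fin numVars × Bool

/-- The assignment `a` satisfies `φ`; a literal `(v, b)` is true when `v` has the value `b`. -/
def Formula.SatisfiedBy (φ : Formula) (a : Fin φ.numVars → Bool) : Prop :=
  ∀ j, ∃ i, a (φ.lit j i).1 = (φ.lit j i).2

def Formula.Satisfiable (φ : Formula) : Prop := ∃ a, φ.SatisfiedBy a

def Formula.encode (φ : Formula) : Dat :=
  .cons (.ofNat φ.numVars) (.ofList (List.ofFn fun j => .ofList (List.ofFn fun i =>
    .cons (.ofNat (φ.lit j i).1) (.ofBool (φ.lit j i).2))))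

/-- Encoding of an assignment: the list of its values. -/
def encodeAssignment {n : ℕ} (a : Fin n → Bool) : Dat :=
  .ofList (List.ofFn fun v => .ofBool (a v))

/-- A factor graph with three variables per constraint: a bipartite graph between variables
and constraints, in which every constraint is adjacent to three distinct variables. -/
structure FactorGraph where
  numVars : ℕ
  numCons : ℕ
  nbr : Fin numCons → Fin 3 ↪ Fin numVars

def FactorGraph.encode (G : FactorGraph) : Dat :=
  .cons (.ofNat G.numVars) (.ofList (List.ofFn fun j => .ofList (List.ofFn fun i =>
    .ofNat (G.nbr j i))))

/-- The 3SAT instance on the factor graph `G` given by a choice of polarities. -/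
def FactorGraph.inst (G : FactorGraph) (pol : Fin G.numCons → Fin 3 → Bool) : Formula where
  numVars := G.numVars
  numClauses := G.numCons
  lit j i := (G.nbr j i, pol j i)

/-! Families of factor graphs. -/

/-- The index pairs of a family of factor graphs. -/
def IsIndex (n m : ℕ) : Prop := 0 < n ∧ 0 < m ∧ m ≤ 2 ^ 3 * n.choose 3

/-- `F` is a uniform family of factor graphs: the numbers of variables and of constraints are
at least `n` and at most polynomial in `n + m`, and the graph of index `(n, m)` is
computable in time polynomial in `n + m`. (Values of `F` off the index pairs are irrelevant.) -/
structure IsUniformFamily (F : ℕ → ℕ → FactorGraph) : Prop where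
  le_numVars : ∀ n m, IsIndex n m → n ≤ (F n m).numVars
  le_numCons : ∀ n m, IsIndex n m → n ≤ (F n m).numCons
  poly_size : ∃ p : Polynomial ℕ, ∀ n m, IsIndex n m →
    (F n m).numVars ≤ p.eval (n + m) ∧ (F n m).numCons ≤ p.eval (n + m)
  poly_time : ∃ (c : Prog) (p : Polynomial ℕ), ∀ n m, IsIndex n m →
    ∃ t ≤ p.eval (n + m), Computes c (.cons (.ofNat n) (.ofNat m)) (F n m).encode t

/-! Computational tasks and the class SUBEXP/poly. -/

/-- A task says which outputs are correct on a formula. -/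
abbrev Task : Type := Formula → Dat → Prop

/-- Decide whether the formula is satisfiable. -/
def decisionTask : Task := fun φ y =>
  (φ.Satisfiable ∧ y = .ofBool true) ∨ (¬ φ.Satisfiable ∧ y = .ofBool false)

/-- Find a satisfying assignment, or report (by the output `nil`) that there is none. -/
def searchTask : Task := fun φ y =>
  (∃ a, φ.SatisfiedBy a ∧ y = .cons .nil (encodeAssignment a)) ∨
    (¬ φ.Satisfiable ∧ y = .nil)

/-- There is a SUBEXP/poly algorithm for the task on the instances in `⋃ n m, I n m`: a program
that, given an advice string which depends only on `(n, m)` and has length polynomial in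
the number of variables plus the number of clauses, outputs a correct answer on each instance of
`I n m` within `2 ^ (C * N ^ (1 - ε))` steps, `N` being its number of variables. -/
def SubexpPolySolvable (task : Task) (I : ℕ → ℕ → Set Formula) : Prop :=
  ∃ (c : Prog) (advice : ℕ → ℕ → List Bool) (p : Polynomial ℕ) (ε C : ℝ), 0 < ε ∧
    ∀ n m, ∀ φ ∈ I n m,
      (advice n m).length ≤ p.eval (φ.numVars + φ.numClauses) ∧
      ∃ (y : Dat) (t : ℕ),
        Computes c (.cons (.ofList ((advice n m).map .ofBool)) φ.encode) y t ∧
        task φ y ∧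
        (t : ℝ) ≤ (2 : ℝ) ^ (C * (φ.numVars : ℝ) ^ (1 - ε))

/-- The instances whose factor graph is the member `(n, m)` of the family. -/
def familyInstances (F : ℕ → ℕ → FactorGraph) (n m : ℕ) : Set Formula :=
  {φ | IsIndex n m ∧ ∃ pol, φ = (F n m).inst pol}

/-- All 3SAT instances with `n > 0` variables and `m > 0` clauses, where `m` is at most the number
`(2 * n) ^ 3` of different clauses. -/
def allInstances (n m : ℕ) : Set Formula :=
  {φ | φ.numVars = n ∧ φ.numClauses = m ∧ 0 < n ∧ 0 < m ∧ m ≤ (2 * n) ^ 3}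

/-- A uniform family of factor graphs is subexp-universal for a task on 3SAT if a SUBEXP/poly
algorithm for the instances on the family yields one for all instances. -/
def IsSubexpUniversal (task : Task) (F : ℕ → ℕ → FactorGraph) : Prop :=
  IsUniformFamily F ∧
    (SubexpPolySolvable task (familyInstances F) → SubexpPolySolvable task allInstances)

end UFG

namespace UFG

/-! ### Composing programs -/

/-! The proof combines an embedding of all formulas with few clauses into one graph with
sparsification in the manner of Impagliazzo, Paturi and Zane.

The graph `universalGraph n m` serves every formula with at most `n` variables and at most `m`
nonempty clauses of at most three literals. It has those variables, three slot variables per clause,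
and a switch that four constraints (using two auxiliary variables) force to be true. One constraint
per clause asks that one of its slots be on. For every slot and every variable `v` there is a
constraint on the slot, `v` and the switch: with the switch negated it says that the slot implies a
literal of `v`; with the switch positive it says nothing. So polarities alone write the formula into
the graph (`exists_inst`, `sat_of_sat_instClauses`, `exists_sat_instClauses`). There are about `3nm`
constraints but only `n + 3m + 3` variables, and time is measured in variables. If `m = O(n ^ (1 +
ε))`, a solver with exponent `1 - ε` therefore runs in time `2 ^ O(n ^ (1 - ε ^ 2))`.

Sparsification brings arbitrary formulas to this form. Many clauses of one length with a common
part, the heart, form a flower; a satisfying assignment satisfies the heart or all petals, and the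
search branches on this, dropping subsumed clauses. The thresholds `D` and `2D²` are such that the
measure `progress` grows by at least 1 in the heart branch and by at least `2D²` in the petal branch
(`children_spec`), but never exceeds `36nD` (`progress_le`). A node without flowers has at most
`24nD²` clauses (`length_le_of_flowers_eq_nil`). With `D = d²` and `d = ⌈n ^ (ε / 4)⌉`, powers of `1
+ 1 / d³` dominate the recursion (`branching_inequality`), so the tree has size `exp (O(n / d)) = 2
^ O(n ^ (1 - ε / 4))`.

A depth-first search through this tree calls the given algorithm at the leaves and returns the first
positive answer, cut down to the original variables (`exists_reduction`, `search_time`). The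
parameter `d` depends on the real number `ε`, so it is supplied in unary as part of the advice. Both
tasks are treated at once in `subexpPolySolvable_of_family`.

The programs themselves come from a small calculus of polynomial-time functions, `PT`, closed under
composition, pairing, case distinction and bounded folds. Only the search loop, which is not
polynomial, is built by hand. -/

/-- All variables of an expression are below its bound. -/
def Expr.bound : Expr → ℕ
  | .var i => i + 1
  | .nil => 0
  | .cons a b => max a.bound b.bound
  | .hd a => a.bound
  | .tl a => a.bound

/-- All variables of a program are below its bound. -/
def Prog.bound : Prog → ℕ
  | .skip => 0
  | .assign i e => max (i + 1) e.bound
  | .seq p q => max p.bound q.bound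
  | .cond e p q => max e.bound (max p.bound q.bound)
  | .loop e p => max e.bound p.bound

/-- The store that agrees with `s` below `B` and with `r` from `B` on. -/
def Store.merge (B : ℕ) (s r : Store) : Store := fun i => if i < B then s i else r i

theorem Expr.eval_merge {B : ℕ} (s r : Store) {e : Expr} (h : e.bound ≤ B) :
    e.eval (Store.merge B s r) = e.eval s := by
  induction e with
  | var i => simp [Expr.eval, Store.merge, Expr.bound] at *; omega
  | nil => rfl
  | cons a b iha ihb =>
    simp only [Expr.bound, max_le_iff] at h
    simp [Expr.eval, iha h.1, ihb h.2]
  | hd a ih => simp only [Expr.eval, ih h]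
  | tl a ih => simp only [Expr.eval, ih h]

/-- Variables beyond the bound of a program neither influence a run nor change in it. -/
theorem Exec.merge {B : ℕ} (r : Store) {p : Prog} {s s' : Store} {t : ℕ} (h : Exec p s s' t)
    (hB : p.bound ≤ B) : Exec p (Store.merge B s r) (Store.merge B s' r) t := by
  induction h with
  | skip s => exact .skip _
  | assign s i e =>
    simp only [Prog.bound, max_le_iff] at hB
    have := Exec.assign (Store.merge B s r) i e
    rw [Expr.eval_merge _ _ hB.2] at this
    convert this using 1
    funext j
    by_cases hj : j = i
    · subst hj
      have : j < B := by omega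
      simp [Store.merge, this]
    · simp [Store.merge, hj]
  | seq _ _ ih1 ih2 =>
    simp only [Prog.bound, max_le_iff] at hB
    exact .seq (ih1 hB.1) (ih2 hB.2)
  | cond_true he _ ih =>
    simp only [Prog.bound, max_le_iff] at hB
    exact .cond_true (by rwa [Expr.eval_merge _ _ hB.1]) (ih hB.2.1)
  | cond_false he _ ih =>
    simp only [Prog.bound, max_le_iff] at hB
    exact .cond_false (by rwa [Expr.eval_merge _ _ hB.1]) (ih hB.2.2)
  | loop_true he _ _ ih1 ih2 =>
    have hB' := hB
    simp only [Prog.bound, max_le_iff] at hB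
    exact .loop_true (by rwa [Expr.eval_merge _ _ hB.1]) (ih1 hB.2) (ih2 hB')
  | loop_false he =>
    simp only [Prog.bound, max_le_iff] at hB
    exact .loop_false (by rwa [Expr.eval_merge _ _ hB.1])

theorem Exec.congr {p : Prog} {s s' s'' : Store} {t t' : ℕ} (h : Exec p s s' t)
    (ht : t = t') (hs : s' = s'') : Exec p s s'' t' := hs ▸ ht ▸ h

/-- The initial store for the input `x`. -/
def Store.init (x : Dat) : Store := Function.update (fun _ => Dat.nil) 0 x

/-- Clears the variables `1, …, k`. -/
def clear : ℕ → Prog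
  | 0 => .skip
  | k + 1 => .seq (clear k) (.assign (k + 1) .nil)

theorem exec_clear (s : Store) (k : ℕ) :
    Exec (clear k) s (fun i => if 1 ≤ i ∧ i ≤ k then .nil else s i) (2 * k + 1) := by
  induction k with
  | zero =>
    refine (Exec.skip s).congr rfl ?_
    funext i
    have : ¬ (1 ≤ i ∧ i ≤ 0) := by omega
    simp only [if_neg this]
  | succ k ih =>
    refine (Exec.seq ih (Exec.assign _ (k + 1) .nil)).congr (by simp [Expr.cost]; ring) ?_
    funext i
    by_cases hi : i = k + 1
    · subst hi; simp [Expr.eval]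
    · have : (1 ≤ i ∧ i ≤ k + 1) ↔ (1 ≤ i ∧ i ≤ k) := by omega
      simp [hi, this]

/-- `p` followed by a clearing of all its variables but the output variable. -/
def Prog.clean (p : Prog) : Prog := .seq p (clear p.bound)

/-- Makes `p` usable as a subroutine: data saved from `B` on survive, and the clearing restores the
kind of store in which the next program expects to start. -/
theorem Computes.exec_clean {p : Prog} {x y : Dat} {t : ℕ} (h : Computes p x y t) {B : ℕ}
    (hB : p.bound < B) (r : Store) :
    Exec p.clean (Store.merge B (Store.init x) r) (Store.merge B (Store.init y) r)
      (t + (2 * p.bound + 1)) := by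
  obtain ⟨s', h, rfl⟩ := h
  have h3 := h.merge (B := p.bound + 1) (fun _ => .nil) (Nat.le_succ _)
  have h4 : Store.merge (p.bound + 1) (Store.init x) (fun _ => .nil) = Store.init x := by
    funext i
    simp only [Store.merge, Store.init, Function.update_apply]
    split_ifs <;> first | rfl | omega
  have h5 := (Exec.merge (B := B) r h3 hB.le).seq (exec_clear _ p.bound)
  have h6 : Store.merge (p.bound + 1) (Function.update (fun _ => Dat.nil) 0 x) (fun _ => .nil)
    = Store.init x := h4
  rw [h6] at h5
  refine h5.congr rfl ?_
  funext i
  simp only [Store.merge, Store.init, Function.update_apply]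
  split_ifs <;> first | rfl | omega | (congr 1)

/-- On input `x`, the program `p` halts with output `y` within `t` steps. -/
def Within (p : Prog) (x y : Dat) (t : ℕ) : Prop := ∃ t' ≤ t, Computes p x y t'

theorem Within.mono {p : Prog} {x y : Dat} {t t' : ℕ} (h : Within p x y t) (ht : t ≤ t') :
    Within p x y t' := by
  obtain ⟨u, hu, h⟩ := h
  exact ⟨u, hu.trans ht, h⟩

theorem within_expr (e : Expr) (x : Dat) :
    Within (.assign 0 e) x (e.eval (Store.init x)) (e.cost + 1) :=
  ⟨_, le_rfl, _, Exec.assign _ _ _, by simp [Store.init]⟩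

/-- In this and the following constructions the overhead `k` is fixed before the inputs, so it
depends on the programs only. -/
theorem exists_comp (p q : Prog) : ∃ r k, ∀ x y z t t', Within p x y t → Within q y z t' →
    Within r x z (t + t' + k) := by
  refine ⟨.seq p.clean q, 2 * p.bound + 1, ?_⟩
  rintro x y z t t' ⟨u, hu, h⟩ ⟨u', hu', s, h', hs⟩
  have h1 := h.exec_clean (Nat.lt_succ_self _) (fun _ => .nil)
  have h2 : ∀ x, Store.merge (p.bound + 1) (Store.init x) (fun _ => .nil) = Store.init x := by
    intro x
    funext i
    simp only [Store.merge, Store.init, Function.update_apply]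
    split_ifs <;> first | rfl | omega
  rw [h2, h2] at h1
  exact ⟨_, by omega, s, h1.seq h', hs⟩

theorem exists_pair (p q : Prog) : ∃ r k, ∀ x y z t t', Within p x y t → Within q x z t' →
    Within r x (.cons y z) (t + t' + k) := by
  -- Beyond the variables of both programs: `B` keeps the input, and `B + 1` the first output.
  obtain ⟨B, hB⟩ : ∃ B, B = p.bound + q.bound + 1 := ⟨_, rfl⟩
  refine ⟨.seq (.assign B (.var 0)) (.seq p.clean (.seq (.assign (B + 1) (.var 0))
    (.seq (.assign 0 (.var B)) (.seq q.clean (.assign 0 (.cons (.var (B + 1)) (.var 0))))))),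
    2 * p.bound + 2 * q.bound + 12, ?_⟩
  rintro x y z t t' ⟨u, hu, h⟩ ⟨u', hu', h'⟩
  have e1 : Exec (.assign B (.var 0)) (Store.init x)
      (Store.merge B (Store.init x) (Function.update (fun _ => .nil) B x)) 2 := by
    refine (Exec.assign _ _ _).congr rfl ?_
    funext i
    simp only [Store.merge, Store.init, Function.update_apply, Expr.eval]
    split_ifs <;> first | rfl | omega
  have e2 := h.exec_clean (B := B) (by omega) (Function.update (fun _ => .nil) B x)
  have e3 : Exec (.assign (B + 1) (.var 0))
      (Store.merge B (Store.init y) (Function.update (fun _ => .nil) B x))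
      (Store.merge B (Store.init y)
        (Function.update (Function.update (fun _ => .nil) B x) (B + 1) y)) 2 := by
    refine (Exec.assign _ _ _).congr rfl ?_
    funext i
    simp only [Store.merge, Store.init, Function.update_apply, Expr.eval]
    split_ifs <;> first | rfl | omega
  have e3' : Exec (.assign 0 (.var B))
      (Store.merge B (Store.init y)
        (Function.update (Function.update (fun _ => .nil) B x) (B + 1) y))
      (Store.merge B (Store.init x)
        (Function.update (Function.update (fun _ => .nil) B x) (B + 1) y)) 2 := by
    refine (Exec.assign _ _ _).congr rfl ?_
    funext i
    simp only [Store.merge, Store.init, Function.update_apply, Expr.eval]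
    split_ifs <;> first | rfl | omega
  have e4 := h'.exec_clean (B := B) (by omega)
    (Function.update (Function.update (fun _ => .nil) B x) (B + 1) y)
  have e5 := Exec.assign (Store.merge B (Store.init z)
    (Function.update (Function.update (fun _ => .nil) B x) (B + 1) y)) 0
    (.cons (.var (B + 1)) (.var 0))
  refine ⟨_, ?_, _, e1.seq (e2.seq (e3.seq (e3'.seq (e4.seq e5)))), ?_⟩
  · simp only [Expr.cost]
    omega
  · have : 0 < B := by omega
    simp [Expr.eval, Store.merge, Store.init, this]

/-- The tested value is consumed: the branches see only the tail. A value needed after the test is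
therefore duplicated by the callers. -/
theorem exists_cond (p q : Prog) : ∃ r k, ∀ a b y t,
    (a ≠ .nil → Within p b y t) → (a = .nil → Within q b y t) →
    Within r (.cons a b) y (t + k) := by
  refine ⟨.cond (.hd (.var 0)) (.seq (.assign 0 (.tl (.var 0))) p)
    (.seq (.assign 0 (.tl (.var 0))) q), 6, ?_⟩
  intro a b y t hp hq
  have e1 : Exec (.assign 0 (.tl (.var 0))) (Store.init (.cons a b)) (Store.init b) 3 := by
    refine (Exec.assign _ _ _).congr rfl ?_
    funext i
    by_cases hi : i = 0 <;> simp [Store.init, Expr.eval, Dat.tl, hi]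
  by_cases ha : a = .nil
  · obtain ⟨u, hu, s, h, hs⟩ := hq ha
    exact ⟨_, by simp only [Expr.cost]; omega, s,
      .cond_false (by simp [Expr.eval, Dat.hd, ha]) (e1.seq h), hs⟩
  · obtain ⟨u, hu, s, h, hs⟩ := hp ha
    exact ⟨_, by simp only [Expr.cost]; omega, s,
      .cond_true (by simp [Expr.eval, Dat.hd, ha]) (e1.seq h), hs⟩

/-- The loop runs as long as the head of its state is not `nil`. Runs are assembled backwards from
the final state, one round at a time. -/
theorem exists_loop (p : Prog) : ∃ r k, (∀ b, Within r (.cons .nil b) (.cons .nil b) k) ∧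
    ∀ a b y z t t', a ≠ .nil → Within p (.cons a b) y t → Within r y z t' →
      Within r (.cons a b) z (t + t' + k) := by
  refine ⟨.loop (.hd (.var 0)) p.clean, 2 * p.bound + 5, ?_, ?_⟩
  · intro b
    exact ⟨_, by simp only [Expr.cost]; omega, _, .loop_false (by simp [Expr.eval, Dat.hd]), by simp⟩
  · rintro a b y z t t' ha ⟨u, hu, h⟩ ⟨u', hu', s, h', hs⟩
    have h1 := h.exec_clean (Nat.lt_succ_self _) (fun _ => .nil)
    have h2 : ∀ x, Store.merge (p.bound + 1) (Store.init x) (fun _ => .nil) = Store.init x := by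
      intro x
      funext i
      simp only [Store.merge, Store.init, Function.update_apply]
      split_ifs <;> first | rfl | omega
    rw [h2, h2] at h1
    exact ⟨_, by simp only [Expr.cost]; omega, s,
      .loop_true (by simpa [Expr.eval, Dat.hd] using ha) h1 h', hs⟩

/-! ### Polynomial-time functions -/

/-- The number of nodes of a tree. -/
def Dat.size : Dat → ℕ
  | .nil => 1
  | .cons a b => a.size + b.size + 1

/-- Types whose values are encoded as data values. -/
class Enc (α : Type) where
  enc : α → Dat

open Enc

instance : Enc ℕ := ⟨Dat.ofNat⟩
instance : Enc Bool := ⟨Dat.ofBool⟩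
instance {α β : Type} [Enc α] [Enc β] : Enc (α × β) := ⟨fun x => .cons (enc x.1) (enc x.2)⟩
instance {α : Type} [Enc α] : Enc (List α) := ⟨fun l => .ofList (l.map enc)⟩

/-- The size of the encoding of a value. -/
def sz {α : Type} [Enc α] (a : α) : ℕ := (enc a).size

section
variable {α β γ δ σ : Type} [Enc α] [Enc β] [Enc γ] [Enc δ] [Enc σ]

theorem enc_pair (a : α) (b : β) : enc (a, b) = .cons (enc a) (enc b) := rfl
theorem enc_cons (a : α) (l : List α) : enc (a :: l) = .cons (enc a) (enc l) := rfl

theorem sz_pair (a : α) (b : β) : sz (a, b) = sz a + sz b + 1 := rfl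
theorem sz_nil : sz ([] : List α) = 1 := rfl
theorem sz_cons (a : α) (l : List α) : sz (a :: l) = sz a + sz l + 1 := rfl
theorem sz_nat (n : ℕ) : sz n = 2 * n + 1 := by
  induction n with
  | zero => rfl
  | succ n ih => change 1 + sz n + 1 = _; omega
theorem sz_bool_le (b : Bool) : sz b ≤ 3 := by cases b <;> decide
theorem sz_pos (a : α) : 1 ≤ sz a := by
  unfold sz; cases enc a <;> simp [Dat.size]

theorem sz_append (l l' : List α) : sz (l ++ l') + 1 = sz l + sz l' := by
  induction l with
  | nil => simp [sz_nil]; ring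
  | cons a l ih => simp only [List.cons_append, sz_cons]; omega

theorem length_lt_sz (l : List α) : l.length < sz l := by
  induction l with
  | nil => simp [sz_nil]
  | cons a l ih => simp only [List.length_cons, sz_cons]; have := sz_pos a; omega

theorem sz_lt_of_mem {l : List α} {a : α} (h : a ∈ l) : sz a < sz l := by
  induction l with
  | nil => simp at h
  | cons b l ih =>
    rw [sz_cons]
    rcases List.mem_cons.1 h with rfl | h
    · omega
    · have := ih h; omega

theorem sz_le_of_forall {l : List α} {k : ℕ} (h : ∀ a ∈ l, sz a ≤ k) :
    sz l ≤ l.length * (k + 1) + 1 := by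
  induction l with
  | nil => simp [sz_nil]
  | cons b l ih =>
    rw [sz_cons, List.length_cons]
    have h1 := h b (by simp)
    have h2 := ih fun a ha => h a (by simp [ha])
    linarith

theorem sz_reverse (l : List α) : sz l.reverse = sz l := by
  induction l with
  | nil => rfl
  | cons a l ih =>
    have := sz_append l.reverse [a]
    simp only [List.reverse_cons, sz_cons, sz_nil] at *
    omega

theorem evalMono (q : Polynomial ℕ) {a b : ℕ} (h : a ≤ b) : q.eval a ≤ q.eval b := by
  rw [Polynomial.eval_eq_sum, Polynomial.eval_eq_sum]
  exact Finset.sum_le_sum fun i _ => Nat.mul_le_mul le_rfl (Nat.pow_le_pow_left h _)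

/-- The function `f` can be computed in polynomial time, and the size of its values is
polynomially bounded. -/
@[fun_prop]
def PT (f : α → β) : Prop := ∃ (p : Prog) (q : Polynomial ℕ), ∀ a,
  Within p (enc a) (enc (f a)) (q.eval (sz a)) ∧ sz (f a) ≤ q.eval (sz a)

/-- Only encodings matter, so a value may change its type: a pair is also a nonempty list, and a
list of zeros is a unary number. -/
theorem PT.of_enc {f : α → β} {g : α → γ} (hf : PT f) (h : ∀ a, enc (f a) = enc (g a)) :
    PT g := by
  obtain ⟨p, q, hf⟩ := hf
  refine ⟨p, q, fun a => ?_⟩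
  have := hf a
  unfold sz at *
  rwa [h a] at this

theorem PT.of_eq {f g : α → β} (hf : PT f) (h : ∀ a, f a = g a) : PT g :=
  hf.of_enc fun a => by rw [h]

/-- A function on encodings with a polynomial-time program. -/
theorem PT.of_expr {f : α → β} (e : Expr) (h : ∀ a, e.eval (Store.init (enc a)) = enc (f a))
    (q : Polynomial ℕ) (hq : ∀ a, sz (f a) ≤ q.eval (sz a)) : PT f := by
  refine ⟨.assign 0 e, q + Polynomial.C (e.cost + 1), fun a => ⟨?_, ?_⟩⟩
  · rw [← h a]
    exact (within_expr e (enc a)).mono (by simp)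
  · have := hq a
    simp
    omega

@[fun_prop]
theorem PT.id : PT (fun a : α => a) :=
  .of_expr (.var 0) (fun a => by simp [Expr.eval, Store.init]) Polynomial.X (by simp)

theorem exists_const (d : Dat) : ∃ e : Expr, ∀ s, e.eval s = d := by
  induction d with
  | nil => exact ⟨.nil, fun _ => rfl⟩
  | cons a b iha ihb =>
    obtain ⟨e, he⟩ := iha
    obtain ⟨e', he'⟩ := ihb
    exact ⟨.cons e e', fun s => by simp [Expr.eval, he, he']⟩

@[fun_prop]
theorem PT.const (b : β) : PT (fun _ : α => b) := by
  obtain ⟨e, he⟩ := exists_const (enc b)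
  exact .of_expr e (fun a => he _) (Polynomial.C (sz b)) (by simp)

-- This is where the size bound in `PT` is needed: since trees are shared, a short run can build an
-- exponentially large tree, so the time of `f` alone does not control the size of the input of `g`.
@[fun_prop]
theorem PT.comp {g : β → γ} {f : α → β} (hg : PT g) (hf : PT f) : PT (fun a => g (f a)) := by
  obtain ⟨p, q, hf⟩ := hf
  obtain ⟨p', q', hg⟩ := hg
  obtain ⟨r, k, hr⟩ := exists_comp p p'
  refine ⟨r, q + q'.comp q + Polynomial.C k, fun a => ⟨(hr _ _ _ _ _ (hf a).1 (hg (f a)).1).mono ?_, ?_⟩⟩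
  · have := evalMono q' (hf a).2
    simp [Polynomial.eval_comp]; omega
  · have := evalMono q' (hf a).2
    have := (hg (f a)).2
    simp [Polynomial.eval_comp]; omega

@[fun_prop]
theorem PT.prodMk {f : α → β} {g : α → γ} (hf : PT f) (hg : PT g) :
    PT (fun a => (f a, g a)) := by
  obtain ⟨p, q, hf⟩ := hf
  obtain ⟨p', q', hg⟩ := hg
  obtain ⟨r, k, hr⟩ := exists_pair p p'
  refine ⟨r, q + q' + Polynomial.C (k + 1), fun a => ⟨(hr _ _ _ _ _ (hf a).1 (hg a).1).mono ?_, ?_⟩⟩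
  · simp
  · have := (hf a).2
    have := (hg a).2
    simp [sz_pair]; omega

@[fun_prop]
theorem PT.fst {f : α → β × γ} (hf : PT f) : PT (fun a => (f a).1) :=
  PT.comp (g := Prod.fst) (.of_expr (.hd (.var 0)) (fun a => by simp [Expr.eval, Store.init, enc, Dat.hd])
    Polynomial.X (fun a => by simp [sz, enc, Dat.size]; omega)) hf

@[fun_prop]
theorem PT.snd {f : α → β × γ} (hf : PT f) : PT (fun a => (f a).2) :=
  PT.comp (g := Prod.snd) (.of_expr (.tl (.var 0)) (fun a => by simp [Expr.eval, Store.init, enc, Dat.tl])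
    Polynomial.X (fun a => by simp [sz, enc, Dat.size]; omega)) hf

@[fun_prop]
theorem PT.cons {f : α → β} {g : α → List β} (hf : PT f) (hg : PT g) :
    PT (fun a => f a :: g a) := (hf.prodMk hg).of_enc fun _ => rfl

@[fun_prop]
theorem PT.succ {f : α → ℕ} (hf : PT f) : PT (fun a => f a + 1) :=
  ((PT.const 0).prodMk hf).of_enc fun _ => rfl

@[fun_prop]
theorem PT.tail {f : α → List β} (hf : PT f) : PT (fun a => (f a).tail) :=
  PT.comp (g := List.tail) (.of_expr (.tl (.var 0))
    (fun a => by cases a <;> simp [Expr.eval, Store.init, enc, Dat.tl, Dat.ofList])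
    Polynomial.X (fun a => by
      cases a <;> simp [sz, enc, Dat.size, Dat.ofList]; omega)) hf

theorem PT.dcond {f : α → β} {g h : α → δ} (hf : PT f) (hg : PT g) (hh : PT h)
    [∀ a, Decidable (enc (f a) = .nil)] :
    PT (fun a => if enc (f a) = .nil then h a else g a) := by
  obtain ⟨p1, q1, hg⟩ := hg
  obtain ⟨p2, q2, hh⟩ := hh
  obtain ⟨p3, q3, hf⟩ := hf.prodMk PT.id
  obtain ⟨r, c, hr⟩ := exists_cond p1 p2
  obtain ⟨r', c', hr'⟩ := exists_comp p3 r
  refine ⟨r', q1 + q2 + q3 + Polynomial.C (c + c'), fun a => ⟨?_, ?_⟩⟩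
  · refine (hr' _ _ _ _ (q1.eval (sz a) + q2.eval (sz a) + c) (hf a).1
      (hr _ _ _ _ (fun ha => ?_) (fun ha => ?_))).mono (by simp; omega)
    · beta_reduce
      rw [if_neg ha]
      exact (hg a).1.mono (by omega)
    · beta_reduce
      rw [if_pos ha]
      exact (hh a).1.mono (by omega)
  · have h1 := (hg a).2
    have h2 := (hh a).2
    beta_reduce
    split_ifs <;> simp <;> omega

@[fun_prop]
theorem PT.bif {c : α → Bool} {f g : α → β} (hc : PT c) (hf : PT f) (hg : PT g) :
    PT (fun a => bif c a then f a else g a) := by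
  classical
  exact (PT.dcond (f := c) hc hf hg).of_eq fun a => by
    cases h : c a <;> simp [enc, Dat.ofBool]

@[fun_prop]
theorem PT.not {c : α → Bool} (hc : PT c) : PT (fun a => !(c a)) :=
  (PT.bif hc (PT.const false) (PT.const true)).of_eq fun a => by cases c a <;> rfl

@[fun_prop]
theorem PT.and {c d : α → Bool} (hc : PT c) (hd : PT d) : PT (fun a => c a && d a) :=
  (PT.bif hc hd (PT.const false)).of_eq fun a => by cases c a <;> rfl

/-- Whether a list is empty. -/
@[fun_prop]
theorem PT.isEmpty {f : α → List β} (hf : PT f) : PT (fun a => (f a).isEmpty) := by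
  classical
  exact (PT.dcond (f := f) (g := fun _ => false) (h := fun _ => true) 
    hf (PT.const _) (PT.const _)).of_eq fun a => by
      cases h : f a <;> simp [enc, Dat.ofList]

/-- The first element of a list, as a list of at most one element. -/
def headL : List β → List β
  | [] => []
  | a :: _ => [a]

@[fun_prop]
theorem PT.headL {f : α → List β} (hf : PT f) : PT (fun a => headL (f a)) := by
  classical
  have h : PT (fun l : List β => UFG.headL l) := by
    obtain ⟨p, q, h⟩ := PT.id (α := List β)
    obtain ⟨r, c, hr⟩ := exists_cond (.assign 0 (.cons (.hd (.var 0)) .nil)) (.assign 0 .nil)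
    obtain ⟨r', c', hr'⟩ := exists_comp (.assign 0 (.cons (.var 0) (.var 0))) r
    refine ⟨r', Polynomial.X + Polynomial.C (9 + c + c'), fun l => ⟨?_, ?_⟩⟩
    · refine (hr' _ _ _ _ _ (within_expr (.cons (.var 0) (.var 0)) (enc l))
        (hr _ _ _ 5 (fun ha => ?_) (fun ha => ?_))).mono
          (by simp [Expr.cost]; have := sz_pos l; omega)
      · cases l with
        | nil => exact absurd rfl ha
        | cons a l => exact (within_expr (.cons (.hd (.var 0)) .nil) _)
      · cases l with
        | nil => exact (within_expr .nil _).mono (by simp [Expr.cost])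
        | cons a l => cases ha
    · cases l <;> simp [UFG.headL, sz_cons, sz_nil]; omega
  exact h.comp hf

/-- Folds of polynomial-time steps, as long as the intermediate values stay small. -/
theorem PT.foldl {l : α → List β} {s₀ : α → σ} {step : α → σ → β → σ} (hl : PT l) (hs : PT s₀)
    (hstep : PT (fun x : α × σ × β => step x.1 x.2.1 x.2.2)) (Q : Polynomial ℕ)
    (hQ : ∀ a, ∀ l', l' <+: l a → sz (l'.foldl (step a) (s₀ a)) ≤ Q.eval (sz a)) :
    PT (fun a => (l a).foldl (step a) (s₀ a)) := by
  obtain ⟨p, q, hp⟩ := hl.prodMk (PT.id.prodMk hs)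
  obtain ⟨ql, hql⟩ : ∃ ql : Polynomial ℕ, ∀ a, sz (l a) ≤ ql.eval (sz a) :=
    let ⟨_, q, h⟩ := hl; ⟨q, fun a => (h a).2⟩
  obtain ⟨ps, qs, hps⟩ := hstep
  obtain ⟨b1, c1, hb1⟩ := exists_comp (.assign 0 (.cons (.hd (.tl (.var 0)))
    (.cons (.tl (.tl (.var 0))) (.hd (.hd (.var 0)))))) ps
  obtain ⟨b2, c2, hb2⟩ := exists_pair b1 (.assign 0 (.var 0))
  obtain ⟨b3, c3, hb3⟩ := exists_comp b2 (.assign 0 (.cons (.tl (.hd (.tl (.var 0))))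
    (.cons (.hd (.tl (.tl (.var 0)))) (.hd (.var 0)))))
  obtain ⟨r, c4, hr0, hr⟩ := exists_loop b3
  -- The loop state consists of the remaining list, the parameter and the accumulator; the loop ends
  -- when the list is empty. `T` bounds every single step.
  have key : ∀ a (T : ℕ) (L : List β) (s : σ),
      (∀ L' b, L' ++ [b] <+: L → qs.eval (sz (a, L'.foldl (step a) s, b)) ≤ T) →
      Within r (enc (L, a, s)) (enc (([] : List β), a, L.foldl (step a) s))
        (L.length * (T + 40 + c1 + c2 + c3 + c4) + c4) := by
    intro a T L
    induction L with
    | nil => intro s _; exact (hr0 _).mono (by omega)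
    | cons b L ih =>
      intro s hT
      have h1 := ih (step a s b) fun L' b' h => by
        have := hT (b :: L') b' (by simpa using h)
        simpa using this
      have h2 : Within b3 (enc (b :: L, a, s)) (enc (L, a, step a s b))
          (T + 40 + c1 + c2 + c3) := by
        have e1 := within_expr (.cons (.hd (.tl (.var 0)))
          (.cons (.tl (.tl (.var 0))) (.hd (.hd (.var 0))))) (enc (b :: L, a, s))
        have e2 := hb1 _ _ _ _ _ e1 (hps (a, s, b)).1
        have e3 := hb2 _ _ _ _ _ e2 (within_expr (.var 0) _)
        have e4 := hb3 _ _ _ _ _ e3 (within_expr _ _)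
        refine e4.mono ?_
        have := hT [] b (by simp)
        simp only [List.foldl_nil] at this
        simp only [Expr.cost]
        omega
      exact (hr _ _ _ _ _ _ (by simp [enc, Dat.ofList]) h2 h1).mono (by
        simp only [List.length_cons]; ring_nf; omega)
  obtain ⟨r1, c5, hr1⟩ := exists_comp p r
  obtain ⟨r2, c6, hr2⟩ := exists_comp r1 (.assign 0 (.tl (.tl (.var 0))))
  let T : Polynomial ℕ := qs.comp (Polynomial.X + Q + ql + Polynomial.C 2)
  refine ⟨r2, q + (ql * (T + Polynomial.C (40 + c1 + c2 + c3 + c4)) + Polynomial.C (c4 + c5 + c6 + 4)) + Q,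
    fun a => ⟨?_, ?_⟩⟩
  · have h1 := key a (T.eval (sz a)) (l a) (s₀ a) (by
      intro L' b h
      simp only [T, Polynomial.eval_comp]
      apply evalMono
      have h1 := hQ a L' ((List.prefix_append _ _).trans h)
      have h2 := hql a
      have h3 : sz b < sz (l a) := sz_lt_of_mem (h.subset (by simp))
      simp [sz_pair]
      omega)
    have h2 := hr2 _ _ _ _ _ (hr1 _ _ _ _ _ (hp a).1 h1) (within_expr (.tl (.tl (.var 0))) _)
    refine h2.mono ?_
    have h3 := (length_lt_sz (l a)).le.trans (hql a)
    have h4 := Nat.mul_le_mul_right (T.eval (sz a) + 40 + c1 + c2 + c3 + c4) h3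
    simp [Expr.cost]
    ring_nf at *
    omega
  · have := hQ a (l a) (List.prefix_refl _)
    simp
    omega

end

/-! ### Polynomial-time operations on lists and numbers -/

section
variable {α β γ δ σ : Type} [Enc α] [Enc β] [Enc γ] [Enc δ] [Enc σ]

theorem PT.exists_sz_le {f : α → β} (hf : PT f) :
    ∃ q : Polynomial ℕ, ∀ a, sz (f a) ≤ q.eval (sz a) :=
  let ⟨_, q, h⟩ := hf; ⟨q, fun a => (h a).2⟩

theorem sz_prefix {l l' : List α} (h : l' <+: l) : sz l' ≤ sz l := by
  obtain ⟨t, rfl⟩ := h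
  have := sz_append l' t
  have := sz_pos t
  omega

@[fun_prop]
theorem PT.reverse {f : α → List β} (hf : PT f) : PT (fun a => (f a).reverse) := by
  obtain ⟨q, hq⟩ := hf.exists_sz_le
  refine (PT.foldl (step := fun _ s b => b :: s) hf (PT.const []) (by fun_prop) q ?_).of_eq
    fun a => ?_
  · intro a l' h
    have := sz_prefix h
    have := hq a
    have := sz_reverse l'
    simp
    omega
  · simp

@[fun_prop]
theorem PT.append {f g : α → List β} (hf : PT f) (hg : PT g) : PT (fun a => f a ++ g a) := by
  obtain ⟨q, hq⟩ := hf.exists_sz_le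
  obtain ⟨q', hq'⟩ := hg.exists_sz_le
  refine (PT.foldl (step := fun _ s b => b :: s) hf.reverse hg (by fun_prop) (q + q') ?_).of_eq
    fun a => ?_
  · intro a l' h
    have h1 := sz_prefix h
    have := sz_reverse l'
    have := sz_reverse (f a)
    have h2 := hq a
    have h3 := hq' a
    have := sz_append l'.reverse (g a)
    simp
    omega
  · simp

theorem sz_flatMap_le {ι : Type} {l : List ι} {f : ι → List β} {k : ℕ} (h : ∀ a ∈ l, sz (f a) ≤ k) :
    sz (l.flatMap f) ≤ l.length * k + 1 := by
  induction l with
  | nil => simp [sz_nil]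
  | cons a l ih =>
    have h1 := h a (by simp)
    have h2 := ih fun a ha => h a (by simp [ha])
    have h3 := sz_append (f a) (l.flatMap f)
    simp only [List.flatMap_cons, List.length_cons]
    linarith

@[fun_prop]
theorem PT.flatMap {l : α → List β} {f : α → β → List γ} (hl : PT l)
    (hf : PT (fun x : α × β => f x.1 x.2)) : PT (fun a => (l a).flatMap (f a)) := by
  obtain ⟨q, hq⟩ := hl.exists_sz_le
  obtain ⟨q', hq'⟩ := hf.exists_sz_le
  have key : ∀ (g : β → List γ) (l : List β) (s : List γ),
      l.foldl (fun s b => s ++ g b) s = s ++ l.flatMap g := by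
    intro g l
    induction l with
    | nil => simp
    | cons b l ih => intro s; simp [ih]
  refine (PT.foldl (step := fun a s b => s ++ f a b) hl (PT.const []) ?_
    (q * q'.comp (Polynomial.X + q + Polynomial.C 1) + Polynomial.C 1) ?_).of_eq fun a => ?_
  · have h1 : PT (fun x : α × List γ × β => f x.1 x.2.2) :=
      hf.comp (f := fun x : α × List γ × β => (x.1, x.2.2)) (by fun_prop)
    fun_prop
  · intro a l' h
    rw [key]
    have h1 := sz_flatMap_le (l := l') (f := f a)
        (k := q'.eval (sz a + q.eval (sz a) + 1)) fun b hb => by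
      refine (hq' (a, b)).trans (evalMono _ ?_)
      have := sz_lt_of_mem (h.subset hb)
      have := hq a
      rw [sz_pair]
      omega
    have h2 : l'.length ≤ q.eval (sz a) :=
      (length_lt_sz l').le.trans ((sz_prefix h).trans (hq a))
    have h3 := Nat.mul_le_mul_right (q'.eval (sz a + q.eval (sz a) + 1)) h2
    simp [Polynomial.eval_comp]
    omega
  · rw [key]; simp

@[fun_prop]
theorem PT.map {l : α → List β} {f : α → β → γ} (hl : PT l)
    (hf : PT (fun x : α × β => f x.1 x.2)) : PT (fun a => (l a).map (f a)) := by
  refine (PT.flatMap (f := fun a b => [f a b]) hl ?_).of_eq fun a => ?_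
  · fun_prop
  · induction l a <;> simp_all

@[fun_prop]
theorem PT.filter {l : α → List β} {f : α → β → Bool} (hl : PT l)
    (hf : PT (fun x : α × β => f x.1 x.2)) : PT (fun a => (l a).filter (f a)) := by
  refine (PT.flatMap (f := fun a b => bif f a b then [b] else []) hl ?_).of_eq fun a => ?_
  · fun_prop
  · induction l a with
    | nil => rfl
    | cons b l ih => cases h : f a b <;> simp_all

@[fun_prop]
theorem PT.any {l : α → List β} {f : α → β → Bool} (hl : PT l)
    (hf : PT (fun x : α × β => f x.1 x.2)) : PT (fun a => (l a).any (f a)) :=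
  (PT.not (PT.isEmpty (PT.filter hl hf))).of_eq fun a => by
    rw [Bool.eq_iff_iff]; simp

@[fun_prop]
theorem PT.all {l : α → List β} {f : α → β → Bool} (hl : PT l)
    (hf : PT (fun x : α × β => f x.1 x.2)) : PT (fun a => (l a).all (f a)) :=
  (PT.not (PT.any (f := fun a b => !(f a b)) hl (PT.not hf))).of_eq fun a => by
    rw [Bool.eq_iff_iff]; simp

/-- Reduces arithmetic on unary numbers to list operations: sums are lengths of concatenations, and
differences come from dropping elements. -/
theorem enc_replicate (n : ℕ) : enc (List.replicate n 0) = enc n := by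
  induction n with
  | zero => rfl
  | succ n ih => rw [List.replicate_succ, enc_cons, ih]; rfl

@[fun_prop]
theorem PT.length {f : α → List β} (hf : PT f) : PT (fun a => (f a).length) := by
  refine (PT.map (f := fun _ _ => 0) hf (PT.const 0)).of_enc fun a => ?_
  rw [← enc_replicate]
  simp

@[fun_prop]
theorem PT.replicate {f : α → ℕ} (hf : PT f) : PT (fun a => List.replicate (f a) 0) :=
  hf.of_enc fun _ => (enc_replicate _).symm

@[fun_prop]
theorem PT.add {f g : α → ℕ} (hf : PT f) (hg : PT g) : PT (fun a => f a + g a) :=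
  (PT.length (hf.replicate.append hg.replicate)).of_eq fun a => by simp

@[fun_prop]
theorem PT.mul {f g : α → ℕ} (hf : PT f) (hg : PT g) : PT (fun a => f a * g a) := by
  refine (PT.length (PT.flatMap (f := fun a _ => List.replicate (g a) 0) hf.replicate ?_)).of_eq
    fun a => by simp
  exact (hg.comp (PT.fst PT.id)).replicate

@[fun_prop]
theorem PT.sub {f g : α → ℕ} (hf : PT f) (hg : PT g) : PT (fun a => f a - g a) := by
  obtain ⟨q, hq⟩ := hf.exists_sz_le
  have key : ∀ (l l' : List ℕ), l'.foldl (fun (s : List ℕ) _ => s.tail) l = l.drop l'.length := by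
    intro l l'
    induction l' generalizing l with
    | nil => simp
    | cons b l' ih => simp [ih]
  refine (PT.length (PT.foldl (step := fun _ s _ => s.tail) hg.replicate hf.replicate
    (by fun_prop) q ?_)).of_eq fun a => ?_
  · intro a l' h
    rw [key]
    have h1 := hq a
    simp only [List.drop_replicate]
    have h2 : sz (List.replicate (f a - l'.length) 0) = sz (f a - l'.length) := by
      unfold sz; rw [enc_replicate]
    rw [h2]
    rw [sz_nat] at *
    omega
  · rw [key]; simp

@[fun_prop]
theorem PT.le {f g : α → ℕ} (hf : PT f) (hg : PT g) : PT (fun a => decide (f a ≤ g a)) :=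
  (hf.sub hg).replicate.isEmpty.of_eq fun a => by
    rw [Bool.eq_iff_iff]; simp [Nat.sub_eq_zero_iff_le]

theorem range_eq_foldl (n : ℕ) : List.range n =
    (List.replicate n 0).foldl (fun s _ => s ++ [s.length]) [] := by
  induction n with
  | zero => rfl
  | succ n ih => rw [List.replicate_succ', List.foldl_append, ← ih, List.range_succ]; simp

@[fun_prop]
theorem PT.range {f : α → ℕ} (hf : PT f) : PT (fun a => List.range (f a)) := by
  obtain ⟨q, hq⟩ := hf.exists_sz_le
  have : PT fun x : α × List ℕ × ℕ => x.2.1 ++ [x.2.1.length] :=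
    PT.append (by fun_prop) (PT.cons (PT.length (by fun_prop)) (PT.const []))
  refine (PT.foldl (step := fun _ s _ => s ++ [s.length]) hf.replicate (PT.const [])
    this (q * (q + Polynomial.C 1) + Polynomial.C 1) ?_).of_eq fun a => (range_eq_foldl _).symm
  intro a l' h
  obtain ⟨k, hk, rfl⟩ : ∃ k ≤ f a, l' = List.replicate k 0 := by
    rw [List.prefix_replicate_iff] at h
    exact ⟨_, h.1, h.2⟩
  rw [← range_eq_foldl]
  have h2 := hq a
  have h1 := sz_le_of_forall (l := List.range k) (k := q.eval (sz a)) fun i hi => by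
    rw [List.mem_range] at hi
    rw [sz_nat] at *
    omega
  rw [sz_nat] at h2
  rw [List.length_range] at h1
  have h3 : k ≤ q.eval (sz a) := by omega
  have h4 := Nat.mul_le_mul_right (q.eval (sz a) + 1) h3
  simp
  omega

@[fun_prop]
theorem PT.drop {f : α → List β} {g : α → ℕ} (hf : PT f) (hg : PT g) :
    PT (fun a => (f a).drop (g a)) := by
  obtain ⟨q, hq⟩ := hf.exists_sz_le
  have key : ∀ (l : List β) (l' : List ℕ),
      l'.foldl (fun (s : List β) _ => s.tail) l = l.drop l'.length := by
    intro l l'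
    induction l' generalizing l with
    | nil => simp
    | cons b l' ih => simp [ih]
  refine (PT.foldl (step := fun _ s _ => s.tail) hg.replicate hf (by fun_prop) q ?_).of_eq
    fun a => ?_
  · intro a l' h
    rw [key]
    have h1 := hq a
    have h2 := sz_append ((f a).take l'.length) ((f a).drop l'.length)
    rw [List.take_append_drop] at h2
    have := sz_pos ((f a).take l'.length)
    omega
  · rw [key]; simp

/-- The element with a given index, as a list of at most one element. -/
def nthL {ι : Type} (l : List ι) (i : ℕ) : List ι := headL (l.drop i)

theorem nthL_eq {ι : Type} (l : List ι) (i : ℕ) : nthL l i = (l[i]?).toList := by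
  have : ∀ l : List ι, UFG.headL l = (l[0]?).toList := by
    intro l; cases l <;> simp [UFG.headL]
  rw [nthL, this]; simp

@[fun_prop]
theorem PT.nthL {f : α → List β} {g : α → ℕ} (hf : PT f) (hg : PT g) :
    PT (fun a => nthL (f a) (g a)) := PT.headL (PT.drop hf hg)

@[fun_prop]
theorem PT.take {f : α → List β} {g : α → ℕ} (hf : PT f) (hg : PT g) :
    PT (fun a => (f a).take (g a)) := by
  refine (PT.flatMap (f := fun a i => UFG.nthL (f a) i) hg.range
    (PT.nthL (hf.comp (PT.fst PT.id)) (PT.snd PT.id))).of_eq fun a => ?_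
  induction g a with
  | zero => simp
  | succ n ih => rw [List.range_succ, List.flatMap_append, ih, List.take_add_one]; simp [UFG.nthL_eq]

/-- Equality of values can be decided in polynomial time. -/
class PTEq (α : Type) [Enc α] [DecidableEq α] : Prop where
  pt : PT (fun x : α × α => decide (x.1 = x.2))

@[fun_prop]
theorem PT.eq [DecidableEq β] [PTEq β] {f g : α → β} (hf : PT f) (hg : PT g) :
    PT (fun a => decide (f a = g a)) := PT.comp PTEq.pt (hf.prodMk hg)

instance : PTEq ℕ where
  pt := (((PT.fst PT.id).le (PT.snd PT.id)).and ((PT.snd PT.id).le (PT.fst PT.id))).of_eq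
    fun x => by rw [Bool.eq_iff_iff]; simp; omega

instance : PTEq Bool where
  pt := (PT.bif (PT.fst PT.id) (PT.snd PT.id) (PT.not (PT.snd PT.id))).of_eq
    fun x => by rcases x with ⟨_ | _, _ | _⟩ <;> rfl

instance [DecidableEq α] [DecidableEq β] [PTEq α] [PTEq β] : PTEq (α × β) where
  pt := ((PT.eq (f := fun x : (α × β) × (α × β) => x.1.1) (g := fun x => x.2.1)
      (by fun_prop) (by fun_prop)).and
    (PT.eq (f := fun x : (α × β) × (α × β) => x.1.2) (g := fun x => x.2.2)
      (by fun_prop) (by fun_prop))).of_eq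
    fun x => by rw [Bool.eq_iff_iff]; simp [Prod.ext_iff]

@[fun_prop]
theorem PT.mem [DecidableEq β] [PTEq β] {f : α → β} {l : α → List β} (hf : PT f) (hl : PT l) :
    PT (fun a => decide (f a ∈ l a)) :=
  (PT.any (f := fun a b => decide (f a = b)) hl (PT.eq (by fun_prop) (by fun_prop))).of_eq
    fun a => by rw [Bool.eq_iff_iff]; simp

@[fun_prop]
theorem PT.subset [DecidableEq β] [PTEq β] {l l' : α → List β} (hl : PT l) (hl' : PT l') :
    PT (fun a => decide (l a ⊆ l' a)) :=
  (PT.all (f := fun a b => decide (b ∈ l' a)) hl (PT.mem (by fun_prop) (by fun_prop))).of_eq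
    fun a => by rw [Bool.eq_iff_iff]; simp [List.subset_def]

end

/-! ### Sparsification: flowers in a set of clauses

Clauses are lists of positive items here. -/

section
variable {α : Type} [DecidableEq α]

/-- The clauses of length `k` that contain the heart `H`. -/
def hits (S : List (List α)) (k : ℕ) (H : List α) : List (List α) :=
  S.filter fun c => decide (c.length = k) && decide (H ⊆ c)

/-- The petals of the flower with heart `H`. -/
def petals (S : List (List α)) (k : ℕ) (H : List α) : List (List α) :=
  (hits S k H).map fun c => c.filter fun x => !decide (x ∈ H)

/-- Adds the clauses of `A` and removes those that they subsume. -/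
def addAll (A S : List (List α)) : List (List α) :=
  A ++ S.filter fun c => !(A.any fun a => decide (a ⊆ c))

/-- Hearts with one item. -/
def singles (S : List (List α)) : List (List α) := S.flatMap fun c => c.map fun x => [x]

/-- Hearts with two items. -/
def pairs (S : List (List α)) : List (List α) :=
  S.flatMap fun c => c.flatMap fun x => (c.filter fun y => !decide (x = y)).map fun y => [x, y]

/-- The hearts from `Hs` whose flowers have at least `θ` petals. -/
def heavy (S : List (List α)) (k θ : ℕ) (Hs : List (List α)) : List (ℕ × List α) :=
  (Hs.filter fun H => decide (θ ≤ (hits S k H).length)).map fun H => (k, H)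

/-- The flowers to branch on, in the order of preference. -/
def flowers (D D' : ℕ) (S : List (List α)) : List (ℕ × List α) :=
  heavy S 2 D (singles S) ++ (heavy S 3 D (pairs S) ++ heavy S 3 D' (singles S))

/-- The branches at the first flower: either its heart or all its petals become clauses. -/
def children (D D' : ℕ) (S : List (List α)) : List (List (List α)) :=
  (headL (flowers D D' S)).flatMap fun f => [addAll [f.2] S, addAll (petals S f.1 f.2) S]

/-! ### Flowers are computable in polynomial time -/

section
variable [Enc α] [PTEq α] {ι : Type} [Enc ι]

@[fun_prop]
theorem PT.hits {S : ι → List (List α)} {k : ι → ℕ} {H : ι → List α} (hS : PT S) (hk : PT k)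
    (hH : PT H) : PT fun i => hits (S i) (k i) (H i) := by
  unfold UFG.hits
  fun_prop

@[fun_prop]
theorem PT.petals {S : ι → List (List α)} {k : ι → ℕ} {H : ι → List α} (hS : PT S) (hk : PT k)
    (hH : PT H) : PT fun i => petals (S i) (k i) (H i) := by
  unfold UFG.petals
  fun_prop

@[fun_prop]
theorem PT.addAll {A S : ι → List (List α)} (hA : PT A) (hS : PT S) :
    PT fun i => addAll (A i) (S i) := by
  unfold UFG.addAll
  fun_prop

@[fun_prop]
theorem PT.heavy {S Hs : ι → List (List α)} {k θ : ι → ℕ} (hS : PT S) (hk : PT k)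
    (hθ : PT θ) (hH : PT Hs) : PT fun i => heavy (S i) (k i) (θ i) (Hs i) := by
  unfold UFG.heavy
  fun_prop

theorem PT.children {S : ι → List (List α)} {D D' : ι → ℕ} (hS : PT S) (hD : PT D)
    (hD' : PT D') : PT fun i => children (D i) (D' i) (S i) := by
  unfold UFG.children flowers singles pairs
  fun_prop
end

/-! ### Clutters and the effect of adding clauses -/

/-- The number of clauses of length `k` that contain `H`. -/
def deg (S : List (List α)) (k : ℕ) (H : List α) : ℕ :=
  S.countP fun c => decide (c.length = k) && decide (H ⊆ c)

theorem length_hits (S : List (List α)) (k : ℕ) (H : List α) :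
    (hits S k H).length = deg S k H := (List.countP_eq_length_filter ..).symm

/-- Sets of nonempty, pairwise incomparable clauses with at most three items each. -/
structure Clutter (Ω : Finset α) (S : List (List α)) : Prop where
  nodup : ∀ c ∈ S, c.Nodup
  pos : ∀ c ∈ S, 1 ≤ c.length
  le_three : ∀ c ∈ S, c.length ≤ 3
  mem : ∀ c ∈ S, ∀ x ∈ c, x ∈ Ω
  anti : S.Pairwise fun c d => ¬ c ⊆ d ∧ ¬ d ⊆ c

variable {Ω : Finset α} {S A : List (List α)}

theorem length_le_of_subset {ι : Type} {c d : List ι} (hc : c.Nodup) (h : c ⊆ d) : c.length ≤ d.length :=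
  (hc.subperm h).length_le

theorem subset_of_length_le {ι : Type} {c d : List ι} (hc : c.Nodup) (h : c ⊆ d)
    (hl : d.length ≤ c.length) : d ⊆ c :=
  ((hc.subperm h).perm_of_length_le hl).symm.subset

theorem Clutter.eq_of_subset (hS : Clutter Ω S) {c d : List α} (hc : c ∈ S) (hd : d ∈ S)
    (h : c ⊆ d) : c = d := by
  by_contra hne
  have : Std.Symm fun c d : List α => ¬ c ⊆ d ∧ ¬ d ⊆ c := ⟨fun _ _ h => ⟨h.2, h.1⟩⟩
  exact (hS.anti.forall hc hd hne).1 h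

/-- Clauses contained in, and shorter than, a clause of a clutter are new. -/
theorem Clutter.fresh (hS : Clutter Ω S) {a C : List α} (hC : C ∈ S) (h : a ⊆ C)
    (hl : a.length < C.length) : ∀ c ∈ S, ¬ c ⊆ a := by
  intro c hc hca
  have := hS.eq_of_subset hc hC (List.Subset.trans hca h)
  subst this
  exact absurd (length_le_of_subset (hS.nodup c hc) hca) (by omega)

/-- Old clauses containing a new one are filtered out, and `hf` excludes old clauses contained in a
new one. -/
theorem Clutter.addAll (hS : Clutter Ω S) (hA : Clutter Ω A)
    (hf : ∀ a ∈ A, ∀ c ∈ S, ¬ c ⊆ a) : Clutter Ω (addAll A S) := by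
  have key : ∀ c ∈ UFG.addAll A S, c ∈ A ∨ c ∈ S := by
    intro c hc
    simp only [UFG.addAll, List.mem_append, List.mem_filter] at hc
    tauto
  refine ⟨fun c hc => ?_, fun c hc => ?_, fun c hc => ?_, fun c hc => ?_, ?_⟩
  · exact (key c hc).elim (hA.nodup c) (hS.nodup c)
  · exact (key c hc).elim (hA.pos c) (hS.pos c)
  · exact (key c hc).elim (hA.le_three c) (hS.le_three c)
  · exact (key c hc).elim (hA.mem c) (hS.mem c)
  · rw [UFG.addAll, List.pairwise_append]
    refine ⟨hA.anti, hS.anti.filter _, fun a ha c hc => ?_⟩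
    simp only [List.mem_filter, Bool.not_eq_true', List.any_eq_false, decide_eq_true_eq] at hc
    exact ⟨hc.2 a ha, hf a ha c hc.1⟩

/-- The number of clauses of length `k`. -/
def cnt {ι : Type} (k : ℕ) (S : List (List ι)) : ℕ := S.countP fun c => decide (c.length = k)

theorem countP_any_le {ι κ : Type} (A : List ι) (S : List κ) (p : κ → Bool) (q : ι → κ → Bool)
    (K : ℕ) (hK : ∀ a ∈ A, S.countP (fun c => p c && q a c) ≤ K) :
    S.countP (fun c => p c && A.any fun a => q a c) ≤ A.length * K := by
  induction A with
  | nil => simp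
  | cons a A ih =>
    have h1 := hK a (by simp)
    have h2 := ih fun a ha => hK a (by simp [ha])
    have h3 : S.countP (fun c => p c && (a :: A).any fun a => q a c) ≤
        S.countP (fun c => p c && q a c) + S.countP (fun c => p c && A.any fun a => q a c) := by
      clear h1 h2 ih hK
      induction S with
      | nil => simp
      | cons c S ih =>
        simp only [List.countP_cons, List.any_cons] at *
        cases p c <;> cases q a c <;> simp at * <;> (try split_ifs) <;> omega
    rw [List.length_cons]
    linarith

theorem cnt_addAll (k : ℕ) (A S : List (List α)) : cnt k (addAll A S) +
    S.countP (fun c => decide (c.length = k) && A.any fun a => decide (a ⊆ c)) =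
      cnt k A + cnt k S := by
  rw [cnt, addAll, List.countP_append, List.countP_filter, add_assoc]
  congr 1
  induction S with
  | nil => rfl
  | cons c S ih =>
    simp only [cnt, List.countP_cons] at *
    cases decide (c.length = k) <;> cases A.any (fun a => decide (a ⊆ c)) <;> simp at * <;> omega

theorem cnt_eq_zero {ι : Type} {S : List (List ι)} {k : ℕ} (h : ∀ c ∈ S, c.length ≠ k) : cnt k S = 0 := by
  simpa [cnt] using h

theorem cnt_eq_length {ι : Type} {S : List (List ι)} {k : ℕ} (h : ∀ c ∈ S, c.length = k) : cnt k S = S.length := by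
  rw [cnt, List.countP_eq_length]
  simpa using h

/-- Short clauses are not subsumed by new ones. -/
theorem Clutter.not_subsumed (hA : Clutter Ω A) (hf : ∀ a ∈ A, ∀ c ∈ S, ¬ c ⊆ a)
    {k l : ℕ} (hl : ∀ a ∈ A, a.length = l) (hk : k ≤ l) :
    S.countP (fun c => decide (c.length = k) && A.any fun a => decide (a ⊆ c)) = 0 := by
  rw [List.countP_eq_zero]
  intro c hc
  simp only [Bool.and_eq_true, decide_eq_true_eq, List.any_eq_true, not_and, not_exists]
  rintro hck a ha hac
  exact hf a ha c hc (subset_of_length_le (hA.nodup a ha) hac (by rw [hl a ha]; omega))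

/-- The progress measure of sparsification. -/
def progress (D : ℕ) (S : List (List α)) : ℕ := 4 * D * cnt 1 S + cnt 2 S

/-- Each new unit counts `4D` and, by the degree bound, subsumes at most `2D` clauses with two
items, which leaves a net gain of `2D`. This explains the weight of units in `progress`. -/
theorem progress_addAll_units (hA : Clutter Ω A)
    (hf : ∀ a ∈ A, ∀ c ∈ S, ¬ c ⊆ a) (hl : ∀ a ∈ A, a.length = 1) {D : ℕ}
    (hD : ∀ x, deg S 2 [x] ≤ 2 * D) :
    progress D S + 2 * D * A.length ≤ progress D (addAll A S) := by
  have h1 := cnt_addAll 1 A S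
  have h2 := cnt_addAll 2 A S
  rw [hA.not_subsumed hf hl le_rfl, cnt_eq_length hl] at h1
  have h3 := countP_any_le A S (fun c => decide (c.length = 2)) (fun a c => decide (a ⊆ c))
    (2 * D) fun a ha => by
      obtain ⟨x, rfl⟩ := List.length_eq_one_iff.1 (hl a ha)
      exact hD x
  have h4 : cnt 1 (addAll A S) = A.length + cnt 1 S := by omega
  rw [progress, progress, h4]
  nlinarith

/-- New clauses with two items subsume no clause of length one or two, so each of them counts in
full. -/
theorem progress_addAll_edges (hA : Clutter Ω A)
    (hf : ∀ a ∈ A, ∀ c ∈ S, ¬ c ⊆ a) (hl : ∀ a ∈ A, a.length = 2) {D : ℕ} :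
    progress D (addAll A S) = progress D S + A.length := by
  have h1 := cnt_addAll 1 A S
  have h2 := cnt_addAll 2 A S
  rw [hA.not_subsumed hf hl le_rfl, cnt_eq_length hl] at h2
  rw [hA.not_subsumed hf hl (by norm_num),
    cnt_eq_zero (S := A) (fun c hc => by rw [hl c hc]; norm_num)] at h1
  rw [progress, progress, show cnt 1 (addAll A S) = cnt 1 S by omega]
  omega

theorem deg_addAll_le (A S : List (List α)) (k : ℕ) (H : List α) :
    deg (addAll A S) k H ≤ deg A k H + deg S k H := by
  rw [deg, addAll, List.countP_append]
  exact Nat.add_le_add le_rfl (List.filter_sublist.countP_le)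

theorem length_addAll_le
    (h : A.length ≤ S.countP (fun c => A.any fun a => decide (a ⊆ c))) :
    (addAll A S).length ≤ S.length := by
  rw [addAll, List.length_append, ← List.countP_eq_length_filter]
  have := List.length_eq_countP_add_countP (l := S) (fun c => A.any fun a => decide (a ⊆ c))
  simp only [Bool.not_eq_true] at this
  have h2 : S.countP (fun c => !(A.any fun a => decide (a ⊆ c))) =
    S.countP (fun c => decide ((A.any fun a => decide (a ⊆ c)) = false)) := by
    congr 1; funext c; cases A.any fun a => decide (a ⊆ c) <;> rfl
  omega

theorem length_petal {H c : List α} (hc : c.Nodup) (hH : H.Nodup) (h : H ⊆ c) :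
    (c.filter fun x => !decide (x ∈ H)).length + H.length = c.length := by
  have h1 : (c.filter fun x => decide (x ∈ H)).Perm H := by
    rw [List.perm_ext_iff_of_nodup (hc.filter _) hH]
    intro x
    simp only [List.mem_filter, decide_eq_true_eq]
    exact ⟨fun hx => hx.2, fun hx => ⟨h hx, hx⟩⟩
  have h2 := List.length_eq_length_filter_add (l := c) (fun x => decide (x ∈ H))
  have h3 := h1.length_eq
  omega

theorem mem_hits {k : ℕ} {H c : List α} : c ∈ hits S k H ↔ c ∈ S ∧ c.length = k ∧ H ⊆ c := by
  simp [hits]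

/-- All clauses of a flower contain `H`, so an inclusion between two petals would lift to one
between the clauses. -/
theorem Clutter.petals (hS : Clutter Ω S) {k : ℕ} {H : List α} (hH : H.Nodup) (hk : H.length < k) :
    Clutter Ω (petals S k H) := by
  have key : ∀ a ∈ UFG.petals S k H, ∃ c ∈ S, a = (c.filter fun x => !decide (x ∈ H)) ∧
      a.length + H.length = c.length ∧ c.length = k := by
    intro a ha
    obtain ⟨c, hc, rfl⟩ := List.mem_map.1 ha
    rw [mem_hits] at hc
    exact ⟨c, hc.1, rfl, length_petal (hS.nodup c hc.1) hH hc.2.2, hc.2.1⟩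
  refine ⟨fun a ha => ?_, fun a ha => ?_, fun a ha => ?_, fun a ha => ?_, ?_⟩
  · obtain ⟨c, hc, rfl, -⟩ := key a ha
    exact (hS.nodup c hc).filter _
  · obtain ⟨c, hc, -, h1, h2⟩ := key a ha
    omega
  · obtain ⟨c, hc, -, h1, h2⟩ := key a ha
    have := hS.le_three c hc
    omega
  · obtain ⟨c, hc, rfl, -⟩ := key a ha
    exact fun x hx => hS.mem c hc x (List.mem_of_mem_filter hx)
  · have sub : ∀ c d : List α, H ⊆ d → (c.filter fun x => !decide (x ∈ H)) ⊆
        (d.filter fun x => !decide (x ∈ H)) → c ⊆ d := by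
      intro c d hd h x hx
      by_cases hxH : x ∈ H
      · exact hd hxH
      · exact List.mem_of_mem_filter (h (List.mem_filter.2 ⟨hx, by simpa using hxH⟩))
    rw [UFG.petals, List.pairwise_map]
    have := hS.anti.filter fun c => decide (c.length = k) && decide (H ⊆ c)
    refine List.Pairwise.imp_of_mem ?_ this
    intro c d hc hd hcd
    have hc := mem_hits.1 hc
    have hd := mem_hits.1 hd
    exact ⟨fun h => hcd.1 (sub _ _ hd.2.2 h), fun h => hcd.2 (sub _ _ hc.2.2 h)⟩

theorem fresh_petals (hS : Clutter Ω S) {k : ℕ} {H : List α} (hH : H.Nodup) (hH' : H ≠ []) :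
    ∀ a ∈ petals S k H, ∀ c ∈ S, ¬ c ⊆ a := by
  intro a ha
  obtain ⟨c, hc, rfl⟩ := List.mem_map.1 ha
  rw [mem_hits] at hc
  have := length_petal (hS.nodup c hc.1) hH hc.2.2
  have := List.length_pos_iff.2 hH'
  exact hS.fresh hc.1 List.filter_sublist.subset (by omega)

end

/-! ### Branching on flowers -/

section
variable {α : Type} [DecidableEq α] {Ω : Finset α} {S A : List (List α)}

/-- The set of clauses `S` is satisfied by the set `v` of true items. -/
def Sat (v : α → Prop) (S : List (List α)) : Prop := ∀ c ∈ S, ∃ x ∈ c, v x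

theorem sat_addAll {v : α → Prop} : Sat v (addAll A S) ↔ Sat v A ∧ Sat v S := by
  constructor
  · intro h
    refine ⟨fun c hc => h c (List.mem_append_left _ hc), fun c hc => ?_⟩
    by_cases hA : ∃ a ∈ A, a ⊆ c
    · obtain ⟨a, ha, hac⟩ := hA
      obtain ⟨x, hx, hv⟩ := h a (List.mem_append_left _ ha)
      exact ⟨x, hac hx, hv⟩
    · refine h c (List.mem_append_right _ (List.mem_filter.2 ⟨hc, ?_⟩))
      simpa using hA
  · rintro ⟨h1, h2⟩ c hc
    rcases List.mem_append.1 hc with hc | hc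
    · exact h1 c hc
    · exact h2 c (List.mem_of_mem_filter hc)

/-- If no item of the heart is true, every clause of the flower has its true item in the petal. -/
theorem sat_heart_or_petals {v : α → Prop} (h : Sat v S) (k : ℕ) (H : List α) :
    Sat v [H] ∨ Sat v (petals S k H) := by
  by_cases hH : ∃ x ∈ H, v x
  · left; simpa [Sat] using hH
  · right
    intro a ha
    obtain ⟨c, hc, rfl⟩ := List.mem_map.1 ha
    rw [mem_hits] at hc
    obtain ⟨x, hx, hv⟩ := h c hc.1
    refine ⟨x, List.mem_filter.2 ⟨hx, ?_⟩, hv⟩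
    simpa using fun hxH => hH ⟨x, hxH, hv⟩

/-- The invariants of sparsification. -/
structure Invariant (Ω : Finset α) (D : ℕ) (S : List (List α)) : Prop where
  clutter : Clutter Ω S
  deg_le : ∀ x, deg S 2 [x] ≤ 2 * D

theorem deg_pos_iff {k : ℕ} {H : List α} :
    0 < deg S k H ↔ ∃ c ∈ S, c.length = k ∧ H ⊆ c := by
  simp [deg, List.countP_pos_iff]

theorem deg_lt_of_singles {k θ : ℕ} (hθ : 0 < θ) (h : heavy S k θ (singles S) = []) (x : α) :
    deg S k [x] < θ := by
  by_contra! hx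
  obtain ⟨c, hc, -, hxc⟩ := deg_pos_iff.1 (hθ.trans_le hx)
  have : (k, [x]) ∈ heavy S k θ (singles S) := by
    simp only [heavy, List.mem_map, List.mem_filter, length_hits]
    refine ⟨[x], ⟨?_, by simpa using hx⟩, rfl⟩
    simp only [singles, List.mem_flatMap, List.mem_map]
    exact ⟨c, hc, x, by simpa using hxc, rfl⟩
  simp [h] at this

theorem deg_lt_of_pairs {k θ : ℕ} (hθ : 0 < θ) (h : heavy S k θ (pairs S) = []) {x y : α}
    (hxy : x ≠ y) : deg S k [x, y] < θ := by
  by_contra! hx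
  obtain ⟨c, hc, -, hxc⟩ := deg_pos_iff.1 (hθ.trans_le hx)
  have : (k, [x, y]) ∈ heavy S k θ (pairs S) := by
    simp only [heavy, List.mem_map, List.mem_filter, length_hits]
    refine ⟨[x, y], ⟨?_, by simpa using hx⟩, rfl⟩
    simp only [pairs, List.mem_flatMap, List.mem_map, List.mem_filter]
    simp only [List.cons_subset] at hxc
    exact ⟨c, hc, x, hxc.1, y, ⟨hxc.2.1, by simpa using hxy⟩, rfl⟩
  simp [h] at this

/-- What is known about the first flower. -/
theorem flowers_eq_cons {D D' k : ℕ} {H : List α} {l : List (ℕ × List α)} (hD : 0 < D)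
    (h : flowers D D' S = (k, H) :: l) :
    (k = 2 ∧ (∃ x, H = [x]) ∧ D ≤ deg S k H) ∨
    (k = 3 ∧ (∀ x, deg S 2 [x] < D) ∧ (∃ x y, x ≠ y ∧ H = [x, y]) ∧ D ≤ deg S k H) ∨
    (k = 3 ∧ (∀ x, deg S 2 [x] < D) ∧ (∀ x y, x ≠ y → deg S 3 [x, y] < D) ∧
      (∃ x, H = [x]) ∧ D' ≤ deg S k H) := by
  have key : ∀ k' θ Hs l, heavy S k' θ Hs = (k, H) :: l → k = k' ∧ H ∈ Hs ∧ θ ≤ deg S k H := by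
    intro k' θ Hs l h
    have : (k, H) ∈ heavy S k' θ Hs := by simp [h]
    simp only [heavy, List.mem_map, List.mem_filter, length_hits, Prod.mk.injEq,
      decide_eq_true_eq] at this
    obtain ⟨H', h1, rfl, rfl⟩ := this
    exact ⟨rfl, h1⟩
  have hsing : H ∈ singles S → ∃ x, H = [x] := by
    simp only [singles, List.mem_flatMap, List.mem_map]
    rintro ⟨c, -, x, -, rfl⟩
    exact ⟨x, rfl⟩
  rw [flowers] at h
  cases h2 : heavy S 2 D (singles S) with
  | cons f l' =>
    rw [h2, List.cons_append, List.cons.injEq] at h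
    obtain ⟨h3, h4, h5⟩ := key _ _ _ _ (h.1 ▸ h2)
    exact Or.inl ⟨h3, hsing h4, h5⟩
  | nil =>
    have h2 := deg_lt_of_singles hD h2
    rw [‹heavy S 2 D (singles S) = []›, List.nil_append] at h
    right
    cases h3 : heavy S 3 D (pairs S) with
    | cons f l' =>
      rw [h3, List.cons_append, List.cons.injEq] at h
      obtain ⟨h4, h5, h6⟩ := key _ _ _ _ (h.1 ▸ h3)
      refine Or.inl ⟨h4, h2, ?_, h6⟩
      simp only [pairs, List.mem_flatMap, List.mem_map, List.mem_filter] at h5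
      obtain ⟨c, -, x, -, y, ⟨-, hxy⟩, rfl⟩ := h5
      exact ⟨x, y, by simpa using hxy, rfl⟩
    | nil =>
      rw [h3, List.nil_append] at h
      obtain ⟨h4, h5, h6⟩ := key _ _ _ _ h
      exact Or.inr ⟨h4, h2, fun x y hxy => deg_lt_of_pairs hD h3 hxy, hsing h5, h6⟩

theorem length_petals (S : List (List α)) (k : ℕ) (H : List α) :
    (petals S k H).length = deg S k H := by
  rw [petals, List.length_map, length_hits]

theorem length_of_mem_petals (hS : Clutter Ω S) {k : ℕ} {H : List α} (hH : H.Nodup) {a : List α}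
    (ha : a ∈ petals S k H) : a.length + H.length = k := by
  obtain ⟨c, hc, rfl⟩ := List.mem_map.1 ha
  rw [mem_hits] at hc
  rw [length_petal (hS.nodup c hc.1) hH hc.2.2, hc.2.1]

/-- Every clause of the flower contains its own petal and is removed, so at least as many clauses
leave as enter. This keeps the nodes of the search tree polynomially small. -/
theorem length_addAll_petals_le (k : ℕ) (H : List α) :
    (addAll (petals S k H) S).length ≤ S.length := by
  apply length_addAll_le
  rw [length_petals, deg]
  refine List.countP_mono_left fun c hc h => ?_
  simp only [Bool.and_eq_true, decide_eq_true_eq] at h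
  rw [List.any_eq_true]
  refine ⟨_, List.mem_map.2 ⟨c, mem_hits.2 ⟨hc, h⟩, rfl⟩, ?_⟩
  simp

theorem length_addAll_heart_le {H C : List α} (hC : C ∈ S) (hH : H ⊆ C) :
    (addAll [H] S).length ≤ S.length := by
  apply length_addAll_le
  rw [List.length_singleton, Nat.one_le_iff_ne_zero, ← Nat.pos_iff_ne_zero, List.countP_pos_iff]
  exact ⟨C, hC, by simpa using hH⟩

omit [DecidableEq α] in
theorem Clutter.singleton (hS : Clutter Ω S) {H C : List α} (hC : C ∈ S) (hH : H ⊆ C)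
    (hn : H.Nodup) (h0 : 0 < H.length) : Clutter Ω [H] := by
  have := length_le_of_subset hn hH
  have := hS.le_three C hC
  have := hS.mem C hC
  constructor
  · simpa using hn
  · simpa using Nat.succ_le_of_lt h0
  · simp; omega
  · simp; exact fun x hx => this x (hH hx)
  · simp

theorem deg_eq_zero {k : ℕ} {H : List α} (h : ∀ c ∈ A, c.length ≠ k) : deg A k H = 0 := by
  rw [deg, List.countP_eq_zero]
  intro c hc
  simp [h c hc]

/-- Branching keeps the invariants and makes progress. -/
theorem children_spec {D k : ℕ} {H : List α} {l : List (ℕ × List α)} (hD : 0 < D)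
    (hS : Invariant Ω D S) (h : flowers D (2 * D * D) S = (k, H) :: l) :
    (Invariant Ω D (addAll [H] S) ∧ (addAll [H] S).length ≤ S.length ∧
      progress D S + 1 ≤ progress D (addAll [H] S)) ∧
    (Invariant Ω D (addAll (petals S k H) S) ∧ (addAll (petals S k H) S).length ≤ S.length ∧
      progress D S + 2 * D * D ≤ progress D (addAll (petals S k H) S)) := by
  have hfl := flowers_eq_cons hD h
  have hDD : D ≤ 2 * D * D := by nlinarith
  have hnd : H.Nodup ∧ 0 < H.length ∧ H.length < k ∧ D ≤ deg S k H := by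
    rcases hfl with ⟨rfl, ⟨x, rfl⟩, h⟩ | ⟨rfl, -, ⟨x, y, hxy, rfl⟩, h⟩ | ⟨rfl, -, -, ⟨x, rfl⟩, h⟩ <;>
    · simp; first | exact h | exact ⟨hxy, h⟩ | omega
  obtain ⟨hH, hH0, hHk, hdeg⟩ := hnd
  obtain ⟨C, hC, hCk, hHC⟩ := deg_pos_iff.1 (hD.trans_le hdeg)
  have hc1 : Clutter Ω [H] := hS.clutter.singleton hC hHC hH hH0
  have hf1 : ∀ a ∈ [H], ∀ c ∈ S, ¬ c ⊆ a := by
    simpa using hS.clutter.fresh hC hHC (by omega)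
  have hc2 : Clutter Ω (petals S k H) := hS.clutter.petals hH hHk
  have hf2 := fresh_petals hS.clutter (k := k) hH (List.length_pos_iff.1 hH0)
  have hl2 : ∀ a ∈ petals S k H, a.length = k - H.length := fun a ha => by
    have := length_of_mem_petals hS.clutter hH ha; omega
  have hg1 := hS.clutter.addAll hc1 hf1
  have hg2 := hS.clutter.addAll hc2 hf2
  have hd1 : H.length = 1 → ∀ x, deg (addAll [H] S) 2 [x] ≤ 2 * D := fun hH1 x => by
    have h1 := deg_addAll_le [H] S 2 [x]
    have h2 := deg_eq_zero (A := [H]) (H := [x]) (k := 2) (by simp [hH1])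
    have h3 := hS.deg_le x
    omega
  have hd2 : k - H.length = 1 → ∀ x, deg (addAll (petals S k H) S) 2 [x] ≤ 2 * D :=
    fun hH1 x => by
      have h1 := deg_addAll_le (petals S k H) S 2 [x]
      have h2 := deg_eq_zero (A := petals S k H) (H := [x]) (k := 2)
        (fun c hc => by rw [hl2 c hc]; omega)
      have h3 := hS.deg_le x
      omega
  have hp1 : H.length = 1 → progress D S + 1 ≤ progress D (addAll [H] S) := fun hH1 => by
    have := progress_addAll_units hc1 hf1 (by simpa using hH1) hS.deg_le
    simp only [List.length_singleton] at this
    omega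
  -- There are at least `D` unit petals, each worth `2D`.
  have hp2 : k - H.length = 1 →
      progress D S + 2 * D * D ≤ progress D (addAll (petals S k H) S) := fun hk1 => by
    have := progress_addAll_units hc2 hf2 (fun a ha => by rw [hl2 a ha, hk1]) hS.deg_le
    rw [length_petals] at this
    have := Nat.mul_le_mul_left (2 * D) hdeg
    omega
  refine ⟨⟨⟨hg1, ?_⟩, length_addAll_heart_le hC hHC, ?_⟩,
    ⟨⟨hg2, ?_⟩, length_addAll_petals_le _ _, ?_⟩⟩
  · rcases hfl with ⟨rfl, ⟨x, rfl⟩, h⟩ | ⟨rfl, h2, ⟨x, y, hxy, rfl⟩, h⟩ | ⟨rfl, -, -, ⟨x, rfl⟩, h⟩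
    · exact hd1 rfl
    -- A heart with two items is used only when all degrees in the two-item clauses are below `D`,
    -- so one more such clause is harmless.
    · intro z
      have h1 := deg_addAll_le [[x, y]] S 2 [z]
      have h3 : deg [[x, y]] 2 [z] ≤ 1 := List.countP_le_length
      have h4 := h2 z
      omega
    · exact hd1 rfl
  · rcases hfl with ⟨rfl, ⟨x, rfl⟩, h⟩ | ⟨rfl, h2, ⟨x, y, hxy, rfl⟩, h⟩ | ⟨rfl, -, -, ⟨x, rfl⟩, h⟩
    · exact hp1 rfl
    · exact (progress_addAll_edges hc1 hf1 (by simp)).ge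
    · exact hp1 rfl
  · rcases hfl with ⟨rfl, ⟨x, rfl⟩, h⟩ | ⟨rfl, h2, ⟨x, y, hxy, rfl⟩, h⟩ | ⟨rfl, h2, h3, ⟨x, rfl⟩, h⟩
    · exact hd2 rfl
    · exact hd2 rfl
    -- The order of preference matters here: as no pair is a heavy heart, an item `z ≠ x` shares
    -- fewer than `D` three-item clauses with `x`. The petals thus add at most `D` to a degree that
    -- was below `D`.
    · intro z
      have h1 := deg_addAll_le (petals S 3 [x]) S 2 [z]
      have h4 := h2 z
      have h5 : deg (petals S 3 [x]) 2 [z] ≤ D := by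
        by_cases hzx : x = z
        · subst hzx
          refine le_trans (le_of_eq ?_) (Nat.zero_le _)
          rw [deg, List.countP_eq_zero]
          intro c hc
          obtain ⟨d, hd, rfl⟩ := List.mem_map.1 hc
          simp
        · refine le_trans ?_ (h3 x z hzx).le
          rw [deg, petals, List.countP_map, hits, List.countP_filter]
          refine List.countP_mono_left fun c hc h => ?_
          simp at h ⊢
          tauto
      omega
  · rcases hfl with ⟨rfl, ⟨x, rfl⟩, h⟩ | ⟨rfl, h2, ⟨x, y, hxy, rfl⟩, h⟩ | ⟨rfl, h2, h3, ⟨x, rfl⟩, h⟩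
    · exact hp2 rfl
    · exact hp2 rfl
    -- The petals have two items and are worth only one each, but the threshold provides `2D²` of
    -- them.
    · rw [progress_addAll_edges hc2 hf2 (fun a ha => by rw [hl2 a ha]; rfl), length_petals]
      omega

/-! ### Counting clauses by degrees -/

theorem cnt_le_sum (hS : Clutter Ω S) (k : ℕ) : cnt k S ≤ ∑ x ∈ Ω, deg S k [x] := by
  have key : ∀ S : List (List α), (∀ c ∈ S, 1 ≤ c.length) → (∀ c ∈ S, ∀ x ∈ c, x ∈ Ω) →
      cnt k S ≤ ∑ x ∈ Ω, deg S k [x] := by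
    intro S
    induction S with
    | nil => simp [cnt]
    | cons c S ih =>
      intro h1 h2
      have h3 := ih (fun c hc => h1 c (by simp [hc])) (fun c hc => h2 c (by simp [hc]))
      simp only [cnt, deg, List.countP_cons, Finset.sum_add_distrib] at *
      refine Nat.add_le_add h3 ?_
      obtain ⟨x, hx⟩ := List.exists_mem_of_length_pos (h1 c (by simp))
      refine le_trans ?_ (Finset.single_le_sum
        (f := fun x => if (decide (c.length = k) && decide ([x] ⊆ c)) = true then 1 else 0)
        (fun _ _ => Nat.zero_le _) (h2 c (by simp) x hx))
      simp [hx]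
  exact key S hS.pos hS.mem

theorem cnt_le (hS : Clutter Ω S) {k θ : ℕ} (h : ∀ x, deg S k [x] ≤ θ) :
    cnt k S ≤ Ω.card * θ :=
  (cnt_le_sum hS k).trans ((Finset.sum_le_card_nsmul _ _ _ fun x _ => h x).trans_eq (by simp))

theorem Clutter.deg_one_le (hS : Clutter Ω S) (x : α) : deg S 1 [x] ≤ 1 := by
  rw [← length_hits]
  have h1 := hS.anti.filter fun c => decide (c.length = 1) && decide ([x] ⊆ c)
  have h2 : ∀ c ∈ hits S 1 [x], c = [x] := by
    intro c hc
    obtain ⟨-, h3, h4⟩ := mem_hits.1 hc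
    obtain ⟨y, rfl⟩ := List.length_eq_one_iff.1 h3
    rw [List.mem_singleton.1 (h4 (List.mem_singleton_self x))]
  change (hits S 1 [x]).Pairwise _ at h1
  match h3 : hits S 1 [x] with
  | [] => simp
  | [_] => simp
  | c :: d :: l =>
    rw [h3] at h1 h2
    rw [h2 c (by simp), h2 d (by simp)] at h1
    simp at h1

theorem length_eq_cnt {ι : Type} {S : List (List ι)} (h1 : ∀ c ∈ S, 1 ≤ c.length)
    (h2 : ∀ c ∈ S, c.length ≤ 3) : S.length = cnt 1 S + cnt 2 S + cnt 3 S := by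
  induction S with
  | nil => rfl
  | cons c S ih =>
    have := ih (fun c hc => h1 c (by simp [hc])) (fun c hc => h2 c (by simp [hc]))
    have h3 := h1 c (by simp)
    have h4 := h2 c (by simp)
    simp only [cnt, List.countP_cons, List.length_cons] at *
    interval_cases c.length <;> simp <;> omega

/-- Without flowers, an item lies in at most one unit, fewer than `D` two-item clauses and fewer
than `2D²` three-item clauses; and `1 + D + 2D² ≤ 4D²`. -/
theorem length_le_of_flowers_eq_nil {D : ℕ} (hD : 0 < D) (hS : Invariant Ω D S)
    (h : flowers D (2 * D * D) S = []) : S.length ≤ 4 * D * D * Ω.card := by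
  rw [flowers, List.append_eq_nil_iff, List.append_eq_nil_iff] at h
  have h1 := cnt_le hS.clutter hS.clutter.deg_one_le
  have h2 := cnt_le hS.clutter fun x => (deg_lt_of_singles hD h.1 x).le
  have h3 := cnt_le hS.clutter fun x => (deg_lt_of_singles (by positivity) h.2.2 x).le
  rw [length_eq_cnt hS.clutter.pos hS.clutter.le_three]
  have h4 : 1 + D + 2 * D * D ≤ 4 * D * D := by nlinarith
  have := Nat.mul_le_mul_left Ω.card h4
  nlinarith

/-- Units contribute at most `4D` per item, and the degree invariant gives `2D` per item for the
two-item clauses. -/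
theorem progress_le {D : ℕ} (hS : Invariant Ω D S) : progress D S ≤ 6 * D * Ω.card := by
  have h1 := cnt_le hS.clutter hS.clutter.deg_one_le
  have h2 := cnt_le hS.clutter hS.deg_le
  rw [progress]
  nlinarith

end

/-! ### The universal factor graphs -/

/-- The literals of a formula. -/
def Formula.clauses (φ : Formula) : List (List (ℕ × Bool)) :=
  List.ofFn fun j => List.ofFn fun i => (((φ.lit j i).1 : ℕ), (φ.lit j i).2)

theorem Formula.encode_eq (φ : Formula) : φ.encode = enc (φ.numVars, φ.clauses) := by
  simp only [Formula.encode, Formula.clauses, enc, List.map_ofFn]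
  rfl

/-- The literal `l` is true under the assignment `a`. -/
def LitTrue (a : ℕ → Bool) (l : ℕ × Bool) : Prop := a l.1 = l.2

theorem Formula.satisfiedBy_iff (φ : Formula) (a : ℕ → Bool) :
    φ.SatisfiedBy (fun v => a v) ↔ Sat (LitTrue a) φ.clauses := by
  constructor
  · intro h c hc
    obtain ⟨j, rfl⟩ := List.mem_ofFn.1 hc
    obtain ⟨i, hi⟩ := h j
    exact ⟨_, List.mem_ofFn.2 ⟨i, rfl⟩, hi⟩
  · intro h j
    obtain ⟨l, hl, hl'⟩ := h _ (List.mem_ofFn.2 ⟨j, rfl⟩)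
    obtain ⟨i, rfl⟩ := List.mem_ofFn.1 hl
    exact ⟨i, hl'⟩

/-- Extends an assignment by the value `false`. -/
def extend {n : ℕ} (a : Fin n → Bool) (v : ℕ) : Bool := if h : v < n then a ⟨v, h⟩ else false

theorem extend_val {n : ℕ} (a : Fin n → Bool) : (fun v : Fin n => extend a v) = a := by
  funext v; simp [extend]

/-- The literal in the slot `i` of the clause `j`, as a list of at most one element. Clauses are
filled up with copies of their literals. -/
def slotLit (S : List (List (ℕ × Bool))) (j i : ℕ) : List (ℕ × Bool) :=
  nthL ((nthL S j).flatMap fun c => c ++ (c ++ c)) i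

/-- The clause on a slot, a variable and the switch which is always true: the slot
implies the literal of that variable if this literal is in the slot. -/
def slotClause (n m : ℕ) (S : List (List (ℕ × Bool))) (j i v : ℕ) : List (ℕ × Bool) :=
  [(n + (j + (j + j)) + i, false), (v, (slotLit S j i).any fun l => l.2),
    (n + (m + (m + m)), !((slotLit S j i).any fun l => decide (l.1 = v)))]

/-- The clauses that force the switch to be true. -/
def switchClauses (z : ℕ) : List (List (ℕ × Bool)) :=
  [[(z, true), (z + 1, true), (z + 2, true)], [(z, true), (z + 1, true), (z + 2, false)],
    [(z, true), (z + 1, false), (z + 2, true)], [(z, true), (z + 1, false), (z + 2, false)]]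

/-- A formula with `n` variables and at most `m` clauses as an instance on the universal graph.
Its variables are those of `S`, three slots per clause, the switch and two auxiliary
variables. -/
def instClauses (n m : ℕ) (S : List (List (ℕ × Bool))) : List (List (ℕ × Bool)) :=
  switchClauses (n + (m + (m + m))) ++ (List.range m).flatMap fun j =>
    [(n + (j + (j + j)) + 0, true), (n + (j + (j + j)) + 1, true), (n + (j + (j + j)) + 2, true)] ::
      [0, 1, 2].flatMap fun i => (List.range n).map fun v => slotClause n m S j i v

/-- The constraints of the universal graph. -/
def graphTriples (n m : ℕ) : List (List ℕ) := (instClauses n m []).map fun c => c.map fun l => l.1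

/-- The number of variables of the universal graph. -/
def graphVars (n m : ℕ) : ℕ := n + (m + (m + m)) + 3

/-- The reason for universality: `S` enters through polarities only, so the graph may be defined
from the empty list. -/
theorem map_instClauses (n m : ℕ) (S : List (List (ℕ × Bool))) :
    ((instClauses n m S).map fun c => c.map fun l => l.1) = graphTriples n m := by
  simp [graphTriples, instClauses, switchClauses, slotClause, List.map_flatMap, Function.comp_def]

section
variable {ι : Type} [Enc ι]

theorem PT.instClauses {n m : ι → ℕ} {S : ι → List (List (ℕ × Bool))} (hn : PT n) (hm : PT m)
    (hS : PT S) : PT fun i => instClauses (n i) (m i) (S i) := by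
  unfold UFG.instClauses switchClauses slotClause slotLit
  fun_prop

theorem PT.graphTriples {n m : ι → ℕ} (hn : PT n) (hm : PT m) :
    PT fun i => graphTriples (n i) (m i) :=
  PT.map (PT.instClauses hn hm (PT.const [])) (by fun_prop)

theorem PT.graphVars {n m : ι → ℕ} (hn : PT n) (hm : PT m) :
    PT fun i => graphVars (n i) (m i) := by
  unfold UFG.graphVars
  fun_prop
end

theorem mem_instClauses {n m : ℕ} {S : List (List (ℕ × Bool))} {c : List (ℕ × Bool)} :
    c ∈ instClauses n m S ↔ c ∈ switchClauses (n + (m + (m + m))) ∨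
      ∃ j < m, c = [(n + (j + (j + j)) + 0, true), (n + (j + (j + j)) + 1, true),
        (n + (j + (j + j)) + 2, true)] ∨ ∃ i < 3, ∃ v < n, c = slotClause n m S j i v := by
  have h3 : ∀ p : ℕ → Prop, (∃ i < 3, p i) ↔ p 0 ∨ p 1 ∨ p 2 := by
    intro p
    constructor
    · rintro ⟨i, hi, h⟩
      interval_cases i <;> tauto
    · rintro (h | h | h)
      exacts [⟨0, by norm_num, h⟩, ⟨1, by norm_num, h⟩, ⟨2, by norm_num, h⟩]
  simp only [instClauses, List.mem_append, List.mem_flatMap, List.mem_range, List.mem_cons, h3,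
    List.mem_map, eq_comm (a := c), List.not_mem_nil, or_false, exists_eq_or_imp, exists_eq_left]

theorem graphTriples_spec {n m : ℕ} {t : List ℕ} (ht : t ∈ graphTriples n m) :
    t.length = 3 ∧ t.Nodup ∧ ∀ v ∈ t, v < graphVars n m := by
  obtain ⟨c, hc, rfl⟩ := List.mem_map.1 ht
  rcases mem_instClauses.1 hc with h | ⟨j, hj, rfl | ⟨i, hi, v, hv, rfl⟩⟩
  · simp only [switchClauses, List.mem_cons, List.not_mem_nil, or_false] at h
    rcases h with rfl | rfl | rfl | rfl <;> simp [graphVars]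
  · simp [graphVars]
    omega
  · simp [graphVars, slotClause]
    omega

/-- The universal factor graph for formulas with `n` variables and at most `m` clauses. -/
def universalGraph (n m : ℕ) : FactorGraph where
  numVars := graphVars n m
  numCons := (graphTriples n m).length
  nbr j :=
    have h := graphTriples_spec (List.getElem_mem j.2)
    ⟨fun i => ⟨(graphTriples n m)[j][i]'(by have := h.1; have := i.2; simp only [Fin.getElem_fin] at *; omega),
      h.2.2 _ (List.getElem_mem _)⟩, fun i i' hi => by
        have := (h.2.1.getElem_inj_iff).1 (Fin.mk.inj_iff.1 hi)
        exact Fin.ext this⟩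

theorem ofFn_eq_of_length {α : Type} {l : List α} {k : ℕ} (h : l.length = k) {f : Fin k → α}
    (hf : ∀ i : Fin k, f i = l[i]) : List.ofFn f = l := by
  apply List.ext_getElem
  · simp [h]
  · intro i h1 h2
    simp [hf]

theorem universalGraph_encode (n m : ℕ) :
    (universalGraph n m).encode = enc (graphVars n m, graphTriples n m) := by
  have h : (List.ofFn fun j => List.ofFn fun i => ((universalGraph n m).nbr j i : ℕ)) =
      graphTriples n m := by
    refine ofFn_eq_of_length rfl fun j => ?_
    exact ofFn_eq_of_length (graphTriples_spec (List.getElem_mem j.2)).1 fun i => rfl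
  rw [enc_pair, ← h]
  simp only [FactorGraph.encode, enc, List.map_ofFn]
  rfl

theorem exists_inst (n m : ℕ) (S : List (List (ℕ × Bool))) :
    ∃ pol, ((universalGraph n m).inst pol).clauses = instClauses n m S := by
  -- The polarities are read off the list; both indices are always in range, so the defaults play no
  -- role.
  refine ⟨fun j i => (((instClauses n m S)[(j : ℕ)]?.getD [])[(i : ℕ)]?.getD (0, false)).2, ?_⟩
  have hl : (instClauses n m S).length = (graphTriples n m).length := by
    rw [← map_instClauses n m S, List.length_map]
  refine ofFn_eq_of_length hl fun j => ?_
  have hj : (j : ℕ) < (instClauses n m S).length := by rw [hl]; exact j.2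
  have hg : (graphTriples n m)[(j : ℕ)]'j.2 = ((instClauses n m S)[(j : ℕ)]).map fun l => l.1 := by
    simp only [← map_instClauses n m S, List.getElem_map]
  have h3 : ((instClauses n m S)[(j : ℕ)]).length = 3 := by
    have := (graphTriples_spec (List.getElem_mem j.2)).1
    rwa [hg, List.length_map] at this
  refine ofFn_eq_of_length h3 fun i => ?_
  have hi : (i : ℕ) < ((instClauses n m S)[(j : ℕ)]).length := by rw [h3]; exact i.2
  refine Prod.ext ?_ ?_
  · change ((graphTriples n m)[(j : ℕ)]'j.2)[(i : ℕ)]'_ = _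
    simp [hg]
  · simp [FactorGraph.inst, hj, hi]

/-- Every clause has a slot that is on. The constraint on this slot and the variable of its literal
has the switch negated; as the switch is true, the literal holds. -/
theorem sat_of_sat_instClauses {n m : ℕ} {S : List (List (ℕ × Bool))} {a : ℕ → Bool}
    (h : Sat (LitTrue a) (instClauses n m S)) (hS : S.length ≤ m) (h0 : ∀ c ∈ S, c ≠ [])
    (hn : ∀ c ∈ S, ∀ l ∈ c, l.1 < n) : Sat (LitTrue a) S := by
  have hz : a (n + (m + (m + m))) = true := by
    have h1 : ∀ c ∈ switchClauses (n + (m + (m + m))), ∃ l ∈ c, LitTrue a l :=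
      fun c hc => h c (mem_instClauses.2 (Or.inl hc))
    simp only [switchClauses, List.mem_cons, List.not_mem_nil, or_false, forall_eq_or_imp,
      exists_eq_or_imp, exists_eq_left, LitTrue, forall_eq] at h1
    -- With the switch off, the four clauses would exclude all four values of the auxiliary
    -- variables.
    by_contra h2
    simp only [h2, false_or] at h1
    cases h3 : a (n + (m + (m + m)) + 1) <;> cases h4 : a (n + (m + (m + m)) + 2) <;> simp_all
  intro c hc
  obtain ⟨j, hj, rfl⟩ := List.getElem_of_mem hc
  have hjm : j < m := hj.trans_le hS
  obtain ⟨i, hi, hy⟩ : ∃ i < 3, a (n + (j + (j + j)) + i) = true := by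
    obtain ⟨l, hl, hl'⟩ := h _ (mem_instClauses.2 (Or.inr ⟨j, hjm, Or.inl rfl⟩))
    simp only [List.mem_cons, List.not_mem_nil, or_false] at hl
    rcases hl with rfl | rfl | rfl
    exacts [⟨0, by norm_num, hl'⟩, ⟨1, by norm_num, hl'⟩, ⟨2, by norm_num, hl'⟩]
  have hlen := List.length_pos_iff.2 (h0 _ hc)
  have hi' : i < (S[j] ++ (S[j] ++ S[j])).length := by simp only [List.length_append]; omega
  have hslot : slotLit S j i = [(S[j] ++ (S[j] ++ S[j]))[i]] := by
    simp only [slotLit, nthL_eq, List.getElem?_eq_getElem hj, Option.toList_some,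
      List.flatMap_cons, List.flatMap_nil, List.append_nil, List.getElem?_eq_getElem hi']
  set l := (S[j] ++ (S[j] ++ S[j]))[i] with hl
  have hlm : l ∈ S[j] := by
    have : l ∈ S[j] ++ (S[j] ++ S[j]) := List.getElem_mem _
    simpa using this
  refine ⟨l, hlm, ?_⟩
  obtain ⟨x, hx, hx'⟩ := h _ (mem_instClauses.2
    (Or.inr ⟨j, hjm, Or.inr ⟨i, hi, l.1, hn _ hc _ hlm, rfl⟩⟩))
  simp only [slotClause, hslot, List.mem_cons, List.not_mem_nil, or_false, List.any_cons,
    List.any_nil, Bool.or_false, decide_true, Bool.not_true] at hx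
  rcases hx with rfl | rfl | rfl
  · simp [LitTrue, hy] at hx'
  · exact hx'
  · simp [LitTrue, hz] at hx'

theorem exists_sat_instClauses {n m : ℕ} {S : List (List (ℕ × Bool))} {a : ℕ → Bool}
    (h : Sat (LitTrue a) S) (h3 : ∀ c ∈ S, c.length ≤ 3) :
    ∃ b : ℕ → Bool, Sat (LitTrue b) (instClauses n m S) := by
  -- A slot is on if its literal is true. Slots of clauses beyond the end of `S` are empty and hence
  -- on; their constraints contain the switch positively. The switch and the auxiliary variables are
  -- true.
  let b : ℕ → Bool := fun k => if k < n then a k else if k < n + (m + (m + m)) then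
    (slotLit S ((k - n) / 3) ((k - n) % 3)).all (fun l => decide (a l.1 = l.2)) else true
  have hx : ∀ v < n, b v = a v := fun v hv => by simp [b, hv]
  have hz : b (n + (m + (m + m))) = true := by simp [b]
  have hy : ∀ j < m, ∀ i < 3, b (n + (j + (j + j)) + i) =
      (slotLit S j i).all (fun l => decide (a l.1 = l.2)) := by
    intro j hj i hi
    have h1 : ¬ n + (j + (j + j)) + i < n := by omega
    have h2 : n + (j + (j + j)) + i < n + (m + (m + m)) := by omega
    have h3 : (n + (j + (j + j)) + i - n) / 3 = j := by omega
    have h4 : (n + (j + (j + j)) + i - n) % 3 = i := by omega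
    simp only [b, h1, h2, h3, h4, if_true, if_false]
  refine ⟨b, fun c hc => ?_⟩
  rcases mem_instClauses.1 hc with hc | ⟨j, hj, rfl | ⟨i, hi, v, hv, rfl⟩⟩
  · simp only [switchClauses, List.mem_cons, List.not_mem_nil, or_false] at hc
    rcases hc with rfl | rfl | rfl | rfl <;> exact ⟨(_, true), List.mem_cons_self, hz⟩
  · have key : ∃ i < 3, (slotLit S j i).all (fun l => decide (a l.1 = l.2)) = true := by
      by_cases hjS : j < S.length
      · obtain ⟨l, hl, hl'⟩ := h _ (List.getElem_mem hjS)
        obtain ⟨i, hi, rfl⟩ := List.getElem_of_mem hl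
        refine ⟨i, hi.trans_le (h3 _ (List.getElem_mem hjS)), ?_⟩
        simp only [slotLit, nthL_eq, List.getElem?_eq_getElem hjS, Option.toList_some,
          List.flatMap_cons, List.flatMap_nil, List.append_nil, List.getElem?_append_left hi,
          List.getElem?_eq_getElem hi]
        simpa [LitTrue] using hl'
      · refine ⟨0, by norm_num, ?_⟩
        simp [slotLit, nthL_eq, List.getElem?_eq_none (not_lt.1 hjS)]
    obtain ⟨i, hi, h4⟩ := key
    rw [← hy j hj i hi] at h4
    interval_cases i
    exacts [⟨(_, true), by simp, h4⟩, ⟨(_, true), by simp, h4⟩, ⟨(_, true), by simp, h4⟩]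
  · by_cases hyt : b (n + (j + (j + j)) + i) = true
    · have h4 := hyt
      rw [hy j hj i hi] at h4
      cases hon : (slotLit S j i).any fun l => decide (l.1 = v) with
      | false => exact ⟨_, by simp [slotClause]; right; right; rfl, by simp [LitTrue, hz, hon]⟩
      | true =>
        refine ⟨(v, (slotLit S j i).any fun l => l.2), by simp [slotClause], ?_⟩
        rw [slotLit, nthL_eq] at *
        cases ho : ((nthL S j).flatMap fun c => c ++ (c ++ c))[i]? with
        | none => simp [ho] at hon
        | some l =>
          simp only [ho, Option.toList_some, List.any_cons, List.any_nil, Bool.or_false,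
            decide_eq_true_eq, List.all_cons, List.all_nil, Bool.and_true] at hon h4
          subst hon
          simp [LitTrue, hx _ hv, h4]
    · exact ⟨(n + (j + (j + j)) + i, false), by simp [slotClause], by simpa [LitTrue] using hyt⟩

theorem length_instClauses (n m : ℕ) (S : List (List (ℕ × Bool))) :
    (instClauses n m S).length = 4 + m * (1 + 3 * n) := by
  simp [instClauses, switchClauses, List.length_flatMap]
  ring

theorem isUniformFamily_universalGraph : IsUniformFamily universalGraph := by
  have hlen : ∀ n m, (universalGraph n m).numCons = 4 + m * (1 + 3 * n) := fun n m => by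
    rw [← length_instClauses n m []]
    simp [universalGraph, graphTriples]
  refine ⟨fun n m _ => ?_, fun n m h => ?_, ?_, ?_⟩
  · simp only [universalGraph, graphVars]; omega
  · rw [hlen]
    have := h.2.1
    nlinarith
  · refine ⟨3 * Polynomial.X + 3 + (4 + Polynomial.X * (1 + 3 * Polynomial.X)), fun n m _ => ?_⟩
    rw [hlen]
    simp only [universalGraph, graphVars, Polynomial.eval_add, Polynomial.eval_mul,
      Polynomial.eval_X, Polynomial.eval_one, Polynomial.eval_ofNat]
    constructor <;> nlinarith
  · obtain ⟨c, q, h⟩ := (PT.graphVars (PT.fst PT.id) (PT.snd PT.id)).prodMk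
      (PT.graphTriples (ι := ℕ × ℕ) (PT.fst PT.id) (PT.snd PT.id))
    -- The encoded index has size `2 * (n + m) + 3`.
    refine ⟨c, q.comp (2 * Polynomial.X + 3), fun n m _ => ?_⟩
    obtain ⟨t, ht, hc⟩ := (h (n, m)).1
    refine ⟨t, ht.trans ?_, ?_⟩
    · rw [Polynomial.eval_comp]
      apply evalMono
      simp [sz_pair, sz_nat]
      omega
    · rw [universalGraph_encode]
      exact hc

/-! ### Depth-first search -/

instance : Enc Dat := ⟨fun d => d⟩

/-- A program for depth-first search in binary trees, with the stack of open nodes, a context and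
a result as its state. The children of a node are computed in polynomial time, and the leaves
are passed to the program `c`; the search stops when its output is not `nil`. -/
theorem exists_search (c : Prog) {σ κ ρ : Type} [Enc σ] [Enc κ] [Enc ρ]
    {kids : κ × σ → List σ} {inp : κ × σ → ρ} (hk : PT kids) (hi : PT inp) :
    ∃ (W : Prog) (q : Polynomial ℕ) (k₀ : ℕ), ∀ k : κ,
      (∀ r : Dat, Within W (enc (([] : List σ), k, r)) (enc (([] : List σ), k, r)) k₀) ∧
      (∀ S S₁ S₂ rest (r z : Dat) t, kids (k, S) = [S₁, S₂] →
        Within W (enc (S₁ :: S₂ :: rest, k, r)) z t →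
        Within W (enc (S :: rest, k, r)) z (t + q.eval (sz (k, S)))) ∧
      (∀ S rest (r y z : Dat) t tc, kids (k, S) = [] → Within c (enc (inp (k, S))) y tc →
        (y = .nil → Within W (enc (rest, k, r)) z t) →
        (y ≠ .nil → Within W (enc (([] : List σ), k, y)) z t) →
        Within W (enc (S :: rest, k, r)) z (t + (q.eval (sz (k, S)) + tc))) := by
  obtain ⟨pk, qk, hpk⟩ := hk
  obtain ⟨pi, qi, hpi⟩ := hi
  -- Extracts the context and the top node from the state.
  let sel : Expr := .cons (.hd (.tl (.var 0))) (.hd (.hd (.var 0)))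
  obtain ⟨p1, c1, h1⟩ := exists_comp (.assign 0 sel) pk
  obtain ⟨p2, c2, h2⟩ := exists_pair p1 (.assign 0 (.var 0))
  -- The children are stored twice: one copy is consumed by the test, the other goes onto the stack.
  -- The output of `c` is handled likewise in `p7`.
  obtain ⟨p3, c3, h3⟩ := exists_comp p2 (.assign 0 (.cons (.hd (.var 0)) (.var 0)))
  obtain ⟨p4, c4, h4⟩ := exists_comp (.assign 0 sel) pi
  obtain ⟨p5, c5, h5⟩ := exists_comp p4 c
  obtain ⟨p6, c6, h6⟩ := exists_pair p5 (.assign 0 (.var 0))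
  obtain ⟨p7, c7, h7⟩ := exists_comp p6 (.assign 0 (.cons (.hd (.var 0)) (.var 0)))
  obtain ⟨p8, c8, h8⟩ := exists_comp (.assign 0 (.tl (.var 0))) p7
  obtain ⟨p9, c9, h9⟩ := exists_cond
    (.assign 0 (.cons .nil (.cons (.hd (.tl (.tl (.var 0)))) (.hd (.var 0)))))
    (.assign 0 (.cons (.tl (.hd (.tl (.var 0)))) (.tl (.tl (.var 0)))))
  obtain ⟨p10, c10, h10⟩ := exists_comp p8 p9
  obtain ⟨p11, c11, h11⟩ := exists_cond
    (.assign 0 (.cons (.cons (.hd (.hd (.var 0))) (.cons (.hd (.tl (.hd (.var 0))))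
      (.tl (.hd (.tl (.var 0)))))) (.tl (.tl (.var 0))))) p10
  obtain ⟨p12, c12, h12⟩ := exists_comp p3 p11
  obtain ⟨W, c13, hW0, hW⟩ := exists_loop p12
  have hkids : ∀ S rest (k : κ) (r : Dat), Within p3 (enc (S :: rest, k, r))
      (.cons (enc (kids (k, S))) (.cons (enc (kids (k, S))) (enc (S :: rest, k, r))))
      (qk.eval (sz (k, S)) + (c1 + c2 + c3 + 30)) := by
    intro S rest k r
    have e1 := h1 _ _ _ _ _ (within_expr sel (enc (S :: rest, k, r))) (hpk (k, S)).1
    have e2 := h2 _ _ _ _ _ e1 (within_expr (.var 0) _)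
    have e3 := h3 _ _ _ _ _ e2 (within_expr _ _)
    exact e3.mono (by simp only [Expr.cost, sel]; omega)
  refine ⟨W, qk + qi + Polynomial.C (c1 + c2 + c3 + c4 + c5 + c6 + c7 + c8 + c9 + c10 + c11 + c12 +
    c13 + 200), c13, fun k => ⟨fun r => hW0 _, ?_, ?_⟩⟩
  · intro S S₁ S₂ rest r z t hS h
    have e3 := hkids S rest k r
    have e4 := h12 _ _ _ _ _ e3 (h11 _ _ _ _ (fun _ => within_expr _ _)
      (fun h => by simp [hS, enc, Dat.ofList] at h))
    rw [hS] at e4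
    refine (hW _ _ _ _ _ _ (by simp [enc, Dat.ofList]) e4 h).mono ?_
    simp [Expr.cost]
    omega
  · intro S rest r y z t tc hS hc hz hz'
    have e3 := hkids S rest k r
    have e5 := h8 _ _ _ _ _ (within_expr (.tl (.var 0))
      (.cons (enc (kids (k, S))) (enc (S :: rest, k, r))))
      (h7 _ _ _ _ _ (h6 _ _ _ _ _ (h5 _ _ _ _ _ (h4 _ _ _ _ _
      (within_expr sel (enc (S :: rest, k, r))) (hpi (k, S)).1) hc) (within_expr (.var 0) _))
      (within_expr _ _))
    by_cases hy : y = .nil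
    · have e6 := h10 _ _ _ _ _ e5 (h9 _ _ _ _ (fun h => absurd hy h)
        (fun _ => within_expr _ _))
      have e4 := h12 _ _ _ _ _ e3 (h11 _ _ _ _ (fun h => absurd (by simp [hS, enc, Dat.ofList]) h)
        (fun _ => e6))
      refine (hW _ _ _ _ _ _ (by simp [enc, Dat.ofList]) e4 (hz hy)).mono ?_
      simp [Expr.cost, sel]
      omega
    · have e6 := h10 _ _ _ _ _ e5 (h9 _ _ _ _ (fun _ => within_expr _ _)
        (fun h => absurd h hy))
      have e4 := h12 _ _ _ _ _ e3 (h11 _ _ _ _ (fun h => absurd (by simp [hS, enc, Dat.ofList]) h)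
        (fun _ => e6))
      refine (hW _ _ _ _ _ _ (by simp [enc, Dat.ofList]) e4 (hz' hy)).mono ?_
      simp [Expr.cost, sel]
      omega

/-- The running time of the search when the branches of a node make progress `1` and `Δ`. -/
theorem search_time {c W : Prog} {σ κ ρ : Type} [Enc σ] [Enc κ] [Enc ρ]
    {kids : κ × σ → List σ} {inp : κ × σ → ρ} {q : Polynomial ℕ} {k : κ}
    (hW₁ : ∀ S S₁ S₂ rest (r z : Dat) t, kids (k, S) = [S₁, S₂] →
        Within W (enc (S₁ :: S₂ :: rest, k, r)) z t →
        Within W (enc (S :: rest, k, r)) z (t + q.eval (sz (k, S))))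
    (hW₂ : ∀ S rest (r y z : Dat) t tc, kids (k, S) = [] → Within c (enc (inp (k, S))) y tc →
        (y = .nil → Within W (enc (rest, k, r)) z t) →
        (y ≠ .nil → Within W (enc (([] : List σ), k, y)) z t) →
        Within W (enc (S :: rest, k, r)) z (t + (q.eval (sz (k, S)) + tc)))
    {Inv P : σ → Prop} {pot : σ → ℕ} {Ans : List Bool → Prop} {Δ B T : ℕ} {x : ℝ}
    (hx : 1 ≤ x) (hΔ : x ^ (Δ - 1) + x ^ 0 ≤ x ^ Δ) (hΔ1 : 1 ≤ Δ)
    (hB : ∀ S, Inv S → q.eval (sz (k, S)) ≤ B)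
    (hnode : ∀ S, Inv S → kids (k, S) = [] ∨ ∃ S₁ S₂, kids (k, S) = [S₁, S₂] ∧ Inv S₁ ∧ Inv S₂ ∧
      pot S₁ + 1 ≤ pot S ∧ pot S₂ + Δ ≤ pot S ∧ (P S ↔ P S₁ ∨ P S₂))
    (hleaf : ∀ S, Inv S → kids (k, S) = [] → ∃ y, Within c (enc (inp (k, S))) y T ∧
      ((¬ P S ∧ y = .nil) ∨ (P S ∧ ∃ bs, Ans bs ∧ y = enc (0, bs)))) :
    ∀ p S, Inv S → pot S = p → ∀ rest (r : Dat), ∃ t : ℕ,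
      (t : ℝ) ≤ (2 * x ^ p - 1) * (B + T : ℕ) ∧
      ((¬ P S ∧ ∀ z t', Within W (enc (rest, k, r)) z t' →
          Within W (enc (S :: rest, k, r)) z (t' + t)) ∨
        (P S ∧ ∃ bs, Ans bs ∧ ∀ z t', Within W (enc (([] : List σ), k, enc (0, bs))) z t' →
          Within W (enc (S :: rest, k, r)) z (t' + t))) := by
  -- The statement speaks about continuations: a failed subtree hands over to the rest of the stack,
  -- a successful one to the empty stack, at a cost that is the same for all continuations. The
  -- factor `2 * x ^ p - 1` is the number of nodes of a binary tree with `x ^ p` leaves.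
  intro p
  induction p using Nat.strong_induction_on with
  | _ p ih =>
  intro S hS hp rest r
  have hBS := hB S hS
  rcases hnode S hS with h0 | ⟨S₁, S₂, hk, hS₁, hS₂, hp₁, hp₂, hP⟩
  · obtain ⟨y, hy, hy'⟩ := hleaf S hS h0
    refine ⟨B + T, ?_, ?_⟩
    · have : 1 ≤ x ^ p := one_le_pow₀ hx
      exact le_mul_of_one_le_left (by positivity) (by linarith)
    · rcases hy' with ⟨hn, rfl⟩ | ⟨hn, bs, hbs, rfl⟩
      · exact Or.inl ⟨hn, fun z t' hz => (hW₂ S rest r _ z t' T h0 hy (fun _ => hz)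
          (fun h => absurd rfl h)).mono (by omega)⟩
      · exact Or.inr ⟨hn, bs, hbs, fun z t' hz => (hW₂ S rest r _ z t' T h0 hy
          (fun h => by simp [enc] at h) (fun _ => hz)).mono (by omega)⟩
  · obtain ⟨t₂, ht₂, h₂⟩ := ih _ (by omega) S₂ hS₂ rfl rest r
    obtain ⟨t₁, ht₁, h₁⟩ := ih _ (by omega) S₁ hS₁ rfl (S₂ :: rest) r
    refine ⟨t₁ + t₂ + B, ?_, ?_⟩
    · have e1 : x ^ pot S₁ ≤ x ^ (p - 1) := pow_le_pow_right₀ hx (by omega)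
      have e2 : x ^ pot S₂ ≤ x ^ (p - Δ) := pow_le_pow_right₀ hx (by omega)
      have e3 : x ^ (p - 1) + x ^ (p - Δ) ≤ x ^ p := by
        obtain ⟨u, rfl⟩ : ∃ u, p = u + Δ := ⟨p - Δ, by omega⟩
        have h1 : x ^ (u + Δ - 1) = x ^ u * x ^ (Δ - 1) := by rw [← pow_add]; congr 1; omega
        rw [h1, Nat.add_sub_cancel, pow_add]
        have := mul_le_mul_of_nonneg_left hΔ (by positivity : 0 ≤ x ^ u)
        rw [pow_zero] at this
        linarith
      have e4 : (0 : ℝ) ≤ ((B + T : ℕ) : ℝ) := Nat.cast_nonneg _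
      have e5 : (B : ℝ) ≤ ((B + T : ℕ) : ℝ) := by exact_mod_cast Nat.le_add_right _ _
      push_cast at *
      nlinarith [mul_le_mul_of_nonneg_right (add_le_add (add_le_add e1 e2) e3) e4]
    · have hpush : ∀ z t', Within W (enc (S₁ :: S₂ :: rest, k, r)) z t' →
          Within W (enc (S :: rest, k, r)) z (t' + B) := fun z t' hz =>
        (hW₁ S S₁ S₂ rest r z t' hk hz).mono (by omega)
      rcases h₁ with ⟨hn₁, h₁⟩ | ⟨hn₁, bs, hbs, h₁⟩
      · rcases h₂ with ⟨hn₂, h₂⟩ | ⟨hn₂, bs, hbs, h₂⟩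
        · refine Or.inl ⟨by tauto, fun z t' hz => ?_⟩
          exact (hpush z _ (h₁ z _ (h₂ z t' hz))).mono (by omega)
        · refine Or.inr ⟨by tauto, bs, hbs, fun z t' hz => ?_⟩
          exact (hpush z _ (h₁ z _ (h₂ z t' hz))).mono (by omega)
      · refine Or.inr ⟨by tauto, bs, hbs, fun z t' hz => ?_⟩
        exact (hpush z _ (h₁ z t' hz)).mono (by omega)

/-! ### Estimates -/

theorem cube_le_two_pow {d : ℕ} (hd : 1 ≤ d) : d ^ 3 ≤ 2 ^ (2 * d - 1) := by
  rcases Nat.lt_or_ge d 2 with h | h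
  · interval_cases d; norm_num
  · induction d, h using Nat.le_induction with
    | base => norm_num
    | succ d h ih =>
      rw [show 2 * (d + 1) - 1 = (2 * d - 1) + 2 by omega, pow_add]
      have := ih (by omega)
      have h2 : (d + 1) ^ 3 ≤ 4 * d ^ 3 := by
        obtain ⟨e, rfl⟩ := Nat.exists_eq_add_of_le h
        ring_nf
        nlinarith [sq_nonneg e]
      omega

/-- For `x = 1 + 1 / d³` and `Δ = 2d⁴` the claim amounts to `d³ ≤ x ^ (Δ - 1)`. Bernoulli's
inequality gives `2 ≤ x ^ d³`, and `d³ * (2d - 1) ≤ Δ - 1`, so `d³ ≤ 2 ^ (2d - 1)` suffices. -/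
theorem branching_inequality {d : ℕ} (hd : 1 ≤ d) :
    (1 + 1 / (d : ℝ) ^ 3) ^ (2 * (d * d) * (d * d) - 1) + (1 + 1 / (d : ℝ) ^ 3) ^ 0 ≤
      (1 + 1 / (d : ℝ) ^ 3) ^ (2 * (d * d) * (d * d)) := by
  have hd0 : (0 : ℝ) < (d : ℝ) ^ 3 := by positivity
  set x : ℝ := 1 + 1 / (d : ℝ) ^ 3 with hx
  have hx1 : 1 ≤ x := by rw [hx]; have := one_div_pos.2 hd0; linarith
  have h1 : 2 ≤ x ^ (d ^ 3) := by
    have := one_add_mul_le_pow (a := 1 / (d : ℝ) ^ 3) (by have := one_div_pos.2 hd0; linarith) (d ^ 3)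
    refine le_trans (le_of_eq ?_) this
    push_cast
    field_simp
    norm_num
  have h2 : (d : ℝ) ^ 3 ≤ x ^ (2 * (d * d) * (d * d) - 1) := by
    calc (d : ℝ) ^ 3 ≤ 2 ^ (2 * d - 1) := by exact_mod_cast cube_le_two_pow hd
      _ ≤ (x ^ (d ^ 3)) ^ (2 * d - 1) := pow_le_pow_left₀ (by norm_num) h1 _
      _ = x ^ (d ^ 3 * (2 * d - 1)) := by rw [pow_mul]
      _ ≤ _ := by
        refine pow_le_pow_right₀ hx1 ?_
        have h3 : 1 ≤ d ^ 3 := Nat.one_le_pow _ _ hd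
        have h4 : d ^ 3 * (2 * d - 1) + d ^ 3 = 2 * (d * d) * (d * d) := by
          obtain ⟨e, rfl⟩ := Nat.exists_eq_add_of_le hd
          rw [show 2 * (1 + e) - 1 = 2 * e + 1 by omega]
          ring
        omega
  have h5 : 1 ≤ 2 * (d * d) * (d * d) := Nat.one_le_iff_ne_zero.2 (by positivity)
  obtain ⟨u, hu⟩ := Nat.exists_eq_add_of_le h5
  rw [hu] at h2 ⊢
  rw [Nat.add_sub_cancel_left] at *
  rw [add_comm 1 u, pow_succ, pow_zero]
  have h6 : 1 ≤ x ^ u * (1 / (d : ℝ) ^ 3) := by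
    rw [mul_one_div, one_le_div hd0]; exact h2
  have h7 : x ^ u * x = x ^ u + x ^ u * (1 / (d : ℝ) ^ 3) := by
    nth_rewrite 2 [hx]; ring
  linarith

/-! ### Subexponential bounds and the choice of parameters -/

/-- Functions that are at most `2 ^ O(n ^ β)`. -/
def ExpBounded (β : ℝ) (f : ℕ → ℝ) : Prop :=
  ∃ c : ℝ, 0 ≤ c ∧ ∀ n : ℕ, 0 < n → f n ≤ (2 : ℝ) ^ (c * (n : ℝ) ^ β)

theorem one_le_rpow_nat {n : ℕ} (hn : 0 < n) {β : ℝ} (hβ : 0 ≤ β) : 1 ≤ (n : ℝ) ^ β :=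
  Real.one_le_rpow (by exact_mod_cast hn) hβ

theorem ExpBounded.mono {β : ℝ} {f g : ℕ → ℝ} (hf : ExpBounded β f)
    (h : ∀ n, 0 < n → g n ≤ f n) : ExpBounded β g := by
  obtain ⟨c, hc, hf⟩ := hf
  exact ⟨c, hc, fun n hn => (h n hn).trans (hf n hn)⟩

theorem ExpBounded.mono_exponent {β γ : ℝ} {f : ℕ → ℝ} (hf : ExpBounded β f) (h : β ≤ γ) :
    ExpBounded γ f := by
  obtain ⟨c, hc, hf⟩ := hf
  refine ⟨c, hc, fun n hn => (hf n hn).trans ?_⟩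
  refine Real.rpow_le_rpow_of_exponent_le (by norm_num) (mul_le_mul_of_nonneg_left ?_ hc)
  exact Real.rpow_le_rpow_of_exponent_le (by exact_mod_cast hn) h

theorem ExpBounded.mul {β : ℝ} {f g : ℕ → ℝ} (hf : ExpBounded β f) (hg : ExpBounded β g)
    (hf0 : ∀ n, 0 ≤ f n) : ExpBounded β fun n => f n * g n := by
  obtain ⟨c, hc, hf⟩ := hf
  obtain ⟨c', hc', hg⟩ := hg
  refine ⟨c + c', add_nonneg hc hc', fun n hn => ?_⟩
  rw [add_mul, Real.rpow_add (by norm_num)]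
  exact (mul_le_mul_of_nonneg_left (hg n hn) (hf0 n)).trans
    (mul_le_mul_of_nonneg_right (hf n hn) (by positivity))

theorem ExpBounded.const {β : ℝ} (hβ : 0 ≤ β) (a : ℝ) : ExpBounded β fun _ => a := by
  obtain ⟨k, hk⟩ := exists_nat_ge a
  refine ⟨k, by positivity, fun n hn => ?_⟩
  have h1 : a ≤ (2 : ℝ) ^ (k : ℝ) := by
    rw [Real.rpow_natCast]
    exact hk.trans (by exact_mod_cast Nat.lt_two_pow_self.le)
  refine h1.trans (Real.rpow_le_rpow_of_exponent_le (by norm_num) ?_)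
  exact le_mul_of_one_le_right (by positivity) (one_le_rpow_nat hn hβ)

theorem ExpBounded.add {β : ℝ} (hβ : 0 ≤ β) {f g : ℕ → ℝ} (hf : ExpBounded β f)
    (hg : ExpBounded β g) : ExpBounded β fun n => f n + g n := by
  obtain ⟨c, hc, hf⟩ := hf
  obtain ⟨c', hc', hg⟩ := hg
  refine ((ExpBounded.const hβ 2).mul
    (⟨max c c', le_max_of_le_left hc, fun n _ => le_rfl⟩ :
      ExpBounded β fun n => (2 : ℝ) ^ (max c c' * (n : ℝ) ^ β)) (by norm_num)).mono fun n hn => ?_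
  have h1 := hf n hn
  have h2 := hg n hn
  have h0 : (0 : ℝ) ≤ (n : ℝ) ^ β := by positivity
  have h3 : (2 : ℝ) ^ (c * (n : ℝ) ^ β) ≤ 2 ^ (max c c' * (n : ℝ) ^ β) :=
    Real.rpow_le_rpow_of_exponent_le (by norm_num)
      (mul_le_mul_of_nonneg_right (le_max_left _ _) h0)
  have h4 : (2 : ℝ) ^ (c' * (n : ℝ) ^ β) ≤ 2 ^ (max c c' * (n : ℝ) ^ β) :=
    Real.rpow_le_rpow_of_exponent_le (by norm_num)
      (mul_le_mul_of_nonneg_right (le_max_right _ _) h0)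
  linarith

theorem exp_le_two_rpow {t : ℝ} (ht : 0 ≤ t) : Real.exp t ≤ (2 : ℝ) ^ (2 * t) := by
  rw [Real.rpow_def_of_pos (by norm_num)]
  apply Real.exp_le_exp.2
  have := Real.log_two_gt_d9
  nlinarith

theorem ExpBounded.cast {β : ℝ} (hβ : 0 < β) : ExpBounded β fun n => (n : ℝ) := by
  refine ⟨2 * (1 / β), by positivity, fun n hn => ?_⟩
  have hn0 : (0 : ℝ) < n := by exact_mod_cast hn
  have h1 := Real.log_le_rpow_div hn0.le hβ
  calc (n : ℝ) = Real.exp (Real.log n) := (Real.exp_log hn0).symm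
    _ ≤ Real.exp ((n : ℝ) ^ β / β) := Real.exp_le_exp.2 h1
    _ ≤ (2 : ℝ) ^ (2 * ((n : ℝ) ^ β / β)) := exp_le_two_rpow (by positivity)
    _ = _ := by congr 1; ring

theorem ExpBounded.eval {β : ℝ} (hβ : 0 < β) (q : Polynomial ℕ) :
    ExpBounded β fun n => ((q.eval n : ℕ) : ℝ) := by
  induction q using Polynomial.induction_on with
  | C a => simpa using ExpBounded.const hβ.le (a : ℝ)
  | add p q hp hq => simpa using hp.add hβ.le hq
  | monomial k a h =>
    refine (h.mul (ExpBounded.cast hβ) (fun n => Nat.cast_nonneg _)).mono fun n _ => le_of_eq ?_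
    simp [pow_succ, mul_assoc]

/-- The degree parameter of sparsification. -/
noncomputable def degParam (ε : ℝ) (n : ℕ) : ℕ := ⌈(n : ℝ) ^ (ε / 4)⌉₊

theorem le_degParam (ε : ℝ) (n : ℕ) : (n : ℝ) ^ (ε / 4) ≤ degParam ε n := Nat.le_ceil _

theorem one_le_degParam {ε : ℝ} (hε : 0 < ε) {n : ℕ} (hn : 0 < n) : 1 ≤ degParam ε n := by
  have := (one_le_rpow_nat hn (by positivity : 0 ≤ ε / 4)).trans (le_degParam ε n)
  exact_mod_cast this

theorem degParam_le {ε : ℝ} (hε1 : ε ≤ 1) {n : ℕ} (hn : 0 < n) : degParam ε n ≤ n := by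
  refine Nat.ceil_le.2 ?_
  simpa using Real.rpow_le_rpow_of_exponent_le (x := (n : ℝ)) (by exact_mod_cast hn)
    (by linarith : ε / 4 ≤ 1)

theorem degParam_pow_le {ε : ℝ} (hε : 0 < ε) {n : ℕ} (hn : 0 < n) :
    (degParam ε n : ℝ) ^ 4 ≤ 16 * (n : ℝ) ^ ε := by
  have h1 := one_le_rpow_nat hn (by positivity : 0 ≤ ε / 4)
  have h2 : (degParam ε n : ℝ) ≤ 2 * (n : ℝ) ^ (ε / 4) := by
    have := (Nat.ceil_lt_add_one (by positivity : 0 ≤ (n : ℝ) ^ (ε / 4))).le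
    unfold degParam
    linarith
  calc (degParam ε n : ℝ) ^ 4 ≤ (2 * (n : ℝ) ^ (ε / 4)) ^ 4 :=
        pow_le_pow_left₀ (by positivity) h2 4
    _ = 16 * (n : ℝ) ^ ε := by
        rw [mul_pow, ← Real.rpow_natCast ((n : ℝ) ^ (ε / 4)), ← Real.rpow_mul (by positivity)]
        norm_num

/-- The size of the search tree. -/
theorem expBounded_tree {ε : ℝ} (hε : 0 < ε) : ExpBounded (1 - ε / 4) fun n =>
    (1 + 1 / (degParam ε n : ℝ) ^ 3) ^ (36 * n * (degParam ε n * degParam ε n)) := by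
  refine ⟨72, by norm_num, fun n hn => ?_⟩
  have hn0 : (0 : ℝ) < n := by exact_mod_cast hn
  have hd := one_le_degParam hε hn
  have hdn := le_degParam ε n
  set d := degParam ε n
  have hd0 : (0 : ℝ) < d := by exact_mod_cast hd
  have h1 : (1 + 1 / (d : ℝ) ^ 3) ≤ Real.exp (1 / (d : ℝ) ^ 3) := by
    have := Real.add_one_le_exp (1 / (d : ℝ) ^ 3); linarith
  calc (1 + 1 / (d : ℝ) ^ 3) ^ (36 * n * (d * d))
      ≤ (Real.exp (1 / (d : ℝ) ^ 3)) ^ (36 * n * (d * d)) :=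
        pow_le_pow_left₀ (by positivity) h1 _
    _ = Real.exp (36 * (n / d)) := by
        rw [← Real.exp_nat_mul]; congr 1; push_cast; field_simp
    _ ≤ (2 : ℝ) ^ (2 * (36 * (n / d : ℝ))) := exp_le_two_rpow (by positivity)
    _ ≤ _ := by
        refine Real.rpow_le_rpow_of_exponent_le (by norm_num) ?_
        have h2 : (n : ℝ) / d ≤ (n : ℝ) ^ (1 - ε / 4) := by
          rw [Real.rpow_sub hn0, Real.rpow_one]
          exact div_le_div_of_nonneg_left hn0.le (by positivity) hdn
        linarith

/-- The number of clauses to which formulas with `n` variables are reduced. -/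
def slots (n d : ℕ) : ℕ := 24 * n * (d * d) * (d * d)

/-- The slots number at most `24n * 16n = 384n²`, while `n²` has the coefficient `(4 / 3) * 291 =
388` in `8 * (n + 98).choose 3`. The shift by 98 thus makes the index admissible for all `n`, at the
price of unused variables. -/
theorem isIndex_slots {ε : ℝ} (hε : 0 < ε) (hε1 : ε ≤ 1) {n : ℕ} (hn : 0 < n) :
    IsIndex (n + 98) (slots n (degParam ε n)) := by
  have hd := one_le_degParam hε hn
  have hn1 : (1 : ℝ) ≤ n := by exact_mod_cast hn
  have h1 : (degParam ε n) ^ 4 ≤ 16 * n := by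
    have h2 := degParam_pow_le hε hn
    have h3 : (n : ℝ) ^ ε ≤ n := by
      simpa using Real.rpow_le_rpow_of_exponent_le hn1 hε1
    have : (degParam ε n : ℝ) ^ 4 ≤ 16 * n := by linarith
    exact_mod_cast this
  have h4 : slots n (degParam ε n) = 24 * n * (degParam ε n) ^ 4 := by rw [slots]; ring
  have h6 : 6 * (n + 98).choose 3 = (n + 98) * (n + 97) * (n + 96) := by
    have := Nat.descFactorial_eq_factorial_mul_choose (n + 98) 3
    simp only [Nat.descFactorial_succ, Nat.descFactorial_zero, Nat.factorial] at this
    norm_num at this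
    rw [← this]
    rw [show n + 98 - 2 = n + 96 by omega]
    ring
  refine ⟨by omega, ?_, ?_⟩
  · rw [h4]; positivity
  · rw [h4]
    have h7 := Nat.mul_le_mul_left (24 * n) h1
    generalize (n + 98).choose 3 = X at h6 ⊢
    nlinarith

/-- The graph has `n + 101 + 72nd⁴` variables, which is at most `1254 * n ^ (1 + ε)` because `d⁴ ≤
16 * n ^ ε`; and `(1 + ε) * (1 - ε) = 1 - ε ^ 2`. -/
theorem expBounded_solver {ε ε' : ℝ} (hε : 0 < ε) (hε1 : ε ≤ 1) (hε' : ε ≤ ε') (C : ℝ) :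
    ExpBounded (1 - ε ^ 2) fun n =>
      (2 : ℝ) ^ (C * (graphVars (n + 98) (slots n (degParam ε n)) : ℝ) ^ (1 - ε')) := by
  refine ⟨|C| * (1254 : ℝ) ^ (1 - ε), by positivity, fun n hn => ?_⟩
  refine Real.rpow_le_rpow_of_exponent_le (by norm_num) ?_
  have hn1 : (1 : ℝ) ≤ n := by exact_mod_cast hn
  have hn0 : (0 : ℝ) < n := by linarith
  set N := graphVars (n + 98) (slots n (degParam ε n)) with hN
  have hN1 : (1 : ℝ) ≤ N := by
    have : 1 ≤ N := by rw [hN, graphVars]; omega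
    exact_mod_cast this
  have h1 : (N : ℝ) ≤ 1254 * (n : ℝ) ^ (1 + ε) := by
    have h2 := degParam_pow_le hε hn
    have h3 : (n : ℝ) ^ (1 + ε) = n * (n : ℝ) ^ ε := by
      rw [Real.rpow_add hn0, Real.rpow_one]
    have h4 : 1 ≤ (n : ℝ) ^ ε := one_le_rpow_nat hn hε.le
    have h5 : (N : ℝ) = n + 101 + 72 * n * (degParam ε n : ℝ) ^ 4 := by
      rw [hN, graphVars, slots]; push_cast; ring
    rw [h5, h3]
    nlinarith [mul_le_mul_of_nonneg_left h2 hn0.le, mul_le_mul_of_nonneg_left h4 hn0.le]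
  calc C * (N : ℝ) ^ (1 - ε') ≤ |C| * (N : ℝ) ^ (1 - ε') :=
        mul_le_mul_of_nonneg_right (le_abs_self C) (by positivity)
    _ ≤ |C| * (1254 * (n : ℝ) ^ (1 + ε)) ^ (1 - ε) := by
        refine mul_le_mul_of_nonneg_left ?_ (abs_nonneg C)
        exact (Real.rpow_le_rpow_of_exponent_le hN1 (by linarith)).trans
          (Real.rpow_le_rpow (by linarith) h1 (by linarith))
    _ = |C| * (1254 : ℝ) ^ (1 - ε) * (n : ℝ) ^ (1 - ε ^ 2) := by
        rw [Real.mul_rpow (by norm_num) (by positivity), ← Real.rpow_mul hn0.le, ← mul_assoc]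
        congr 2
        ring

/-! ### The reduction -/

/-- Decodes the unary prefix of the advice. The fold runs from the end of the list and starts afresh
at every `false`. -/
theorem PT.takeWhile {α : Type} [Enc α] {f : α → List Bool} (hf : PT f) :
    PT fun a => (f a).takeWhile fun b => b := by
  obtain ⟨q, hq⟩ := hf.exists_sz_le
  have key : ∀ l : List Bool, l.foldl (fun s b => bif b then b :: s else []) [] =
      l.reverse.takeWhile fun b => b := by
    intro l
    induction l using List.reverseRecOn with
    | nil => rfl
    | append_singleton l b ih => cases b <;> simp [ih]
  refine (PT.foldl (step := fun _ s b => bif b then b :: s else []) hf.reverse (PT.const [])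
    (by fun_prop) q ?_).of_eq fun a => ?_
  · intro a l' h
    rw [key]
    have h1 := sz_prefix (List.takeWhile_prefix (fun b => b) (l := l'.reverse))
    have h2 := sz_prefix h
    rw [sz_reverse] at h1 h2
    exact h1.trans (h2.trans (hq a))
  · rw [key, List.reverse_reverse]

/-- Marks the literals of a clause with their positions. -/
def tag (c : List (ℕ × Bool)) : List ((ℕ × Bool) × ℕ) :=
  ((nthL c 0).map fun l => (l, 0)) ++
    (((nthL c 1).map fun l => (l, 1)) ++ (nthL c 2).map fun l => (l, 2))

theorem tag_eq {c : List (ℕ × Bool)} (h : c.length = 3) :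
    ∃ l₀ l₁ l₂, c = [l₀, l₁, l₂] ∧ tag c = [(l₀, 0), (l₁, 1), (l₂, 2)] := by
  obtain ⟨l₀, l₁, l₂, rfl⟩ := List.length_eq_three.1 h
  exact ⟨l₀, l₁, l₂, rfl, rfl⟩

section
variable {α : Type} [DecidableEq α]

/-- Removes clauses which contain an earlier clause. -/
def distinct (S : List (List α)) : List (List α) :=
  S.foldl (fun s c => bif s.any (fun d => decide (d ⊆ c)) then s else c :: s) []

theorem PT.distinct {ι : Type} [Enc ι] [Enc α] [PTEq α] {S : ι → List (List α)} (hS : PT S) :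
    PT fun i => distinct (S i) := by
  obtain ⟨q, hq⟩ := hS.exists_sz_le
  have key : ∀ l s : List (List α),
      sz (l.foldl (fun s c => bif s.any (fun d => decide (d ⊆ c)) then s else c :: s) s) + 1 ≤
        sz s + sz l := by
    intro l
    induction l with
    | nil => intro s; simp [sz_nil]
    | cons c l ih =>
      intro s
      rw [List.foldl_cons, sz_cons]
      cases s.any fun d => decide (d ⊆ c)
      · have := ih (c :: s)
        rw [sz_cons] at this
        simp only [cond_false]
        omega
      · have := ih s
        simp only [cond_true]
        omega
  refine PT.foldl (step := fun _ s c => bif s.any (fun d => decide (d ⊆ c)) then s else c :: s)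
    hS (PT.const []) (by fun_prop) q ?_
  intro i l' h
  have h1 := key l' []
  rw [sz_nil] at h1
  have h2 := sz_prefix h
  have h3 := hq i
  omega

/-- For clauses of equal length inclusion is symmetric, so testing one direction yields
incomparability. -/
theorem distinct_spec {k : ℕ} {S : List (List α)} (h : ∀ c ∈ S, c.Nodup ∧ c.length = k) :
    (∀ c ∈ distinct S, c ∈ S) ∧ (distinct S).Pairwise (fun c d => ¬ c ⊆ d ∧ ¬ d ⊆ c) ∧
      (∀ c ∈ S, ∃ d ∈ distinct S, d ⊆ c) ∧ (distinct S).length ≤ S.length := by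
  induction S using List.reverseRecOn with
  | nil => simp [distinct]
  | append_singleton S c ih =>
    obtain ⟨h1, h2, h3, h4⟩ := ih fun c hc => h c (by simp [hc])
    have hd : distinct (S ++ [c]) = bif (distinct S).any (fun d => decide (d ⊆ c)) then
      distinct S else c :: distinct S := by simp [distinct]
    rw [hd]
    cases ha : (distinct S).any fun d => decide (d ⊆ c)
    · simp only [cond_false]
      simp only [List.any_eq_false, decide_eq_true_eq] at ha
      refine ⟨?_, ?_, ?_, ?_⟩
      · intro d hd
        rcases List.mem_cons.1 hd with rfl | hd
        · simp
        · simp [h1 d hd]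
      · refine List.pairwise_cons.2 ⟨fun d hd => ⟨fun hcd => ?_, ha d hd⟩, h2⟩
        have hdS := h d (by simp [h1 d hd])
        have hcS := h c (by simp)
        exact ha d hd (subset_of_length_le hcS.1 hcd (by omega))
      · intro d hd
        rcases List.mem_append.1 hd with hd | hd
        · obtain ⟨e, he, hed⟩ := h3 d hd
          exact ⟨e, by simp [he], hed⟩
        · rw [List.mem_singleton] at hd
          subst hd
          exact ⟨d, by simp, List.Subset.refl _⟩
      · simpa using h4
    · simp only [cond_true]
      simp only [List.any_eq_true, decide_eq_true_eq] at ha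
      refine ⟨fun d hd => by simp [h1 d hd], h2, ?_, by simp; omega⟩
      intro d hd
      rcases List.mem_append.1 hd with hd | hd
      · exact h3 d hd
      · rw [List.mem_singleton] at hd
        subst hd
        exact ha

end

/-- The items of formulas with `n` variables. -/
def items (n : ℕ) : Finset ((ℕ × Bool) × ℕ) :=
  (Finset.range n ×ˢ Finset.univ) ×ˢ Finset.range 3

theorem card_items (n : ℕ) : (items n).card = 6 * n := by
  simp [items]; ring

/-- The item `x` is true under the assignment `a`. -/
def ItemTrue (a : ℕ → Bool) (x : (ℕ × Bool) × ℕ) : Prop := LitTrue a x.1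

theorem sat_untag {a : ℕ → Bool} {S : List (List ((ℕ × Bool) × ℕ))} :
    Sat (LitTrue a) (S.map fun c => c.map fun x => x.1) ↔ Sat (ItemTrue a) S := by
  constructor
  · intro h c hc
    obtain ⟨l, hl, hl'⟩ := h _ (List.mem_map_of_mem hc)
    obtain ⟨x, hx, rfl⟩ := List.mem_map.1 hl
    exact ⟨x, hx, hl'⟩
  · intro h c hc
    obtain ⟨d, hd, rfl⟩ := List.mem_map.1 hc
    obtain ⟨x, hx, hx'⟩ := h d hd
    exact ⟨x.1, List.mem_map_of_mem hx, hx'⟩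

/-- Tags keep repeated literals of a clause apart. Hence all initial clauses have exactly three
items, and the degree bound on two-item clauses holds trivially. -/
theorem start_spec {n : ℕ} {L : List (List (ℕ × Bool))}
    (hL : ∀ c ∈ L, c.length = 3 ∧ ∀ l ∈ c, l.1 < n) (D : ℕ) :
    Invariant (items n) D (distinct (L.map tag)) ∧ (distinct (L.map tag)).length ≤ L.length ∧
      ∀ a, Sat (ItemTrue a) (distinct (L.map tag)) ↔ Sat (LitTrue a) L := by
  have hT : ∀ c ∈ L.map tag, c.Nodup ∧ c.length = 3 := by
    intro c hc
    obtain ⟨d, hd, rfl⟩ := List.mem_map.1 hc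
    obtain ⟨l₀, l₁, l₂, -, ht⟩ := tag_eq (hL d hd).1
    rw [ht]
    simp
  obtain ⟨h1, h2, h3, h4⟩ := distinct_spec hT
  refine ⟨⟨⟨fun c hc => (hT c (h1 c hc)).1, fun c hc => ?_, fun c hc => ?_, ?_, h2⟩, ?_⟩, ?_, ?_⟩
  · rw [(hT c (h1 c hc)).2]; norm_num
  · rw [(hT c (h1 c hc)).2]
  · intro c hc
    obtain ⟨d, hd, rfl⟩ := List.mem_map.1 (h1 c hc)
    obtain ⟨l₀, l₁, l₂, hd', ht⟩ := tag_eq (hL d hd).1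
    have := (hL d hd).2
    rw [hd'] at this
    rw [ht]
    simpa [items] using this
  · intro x
    rw [deg_eq_zero fun c hc => by rw [(hT c (h1 c hc)).2]; norm_num]
    exact Nat.zero_le _
  · simpa using h4
  · intro a
    have h5 : Sat (ItemTrue a) (L.map tag) ↔ Sat (LitTrue a) L := by
      rw [← sat_untag, List.map_map]
      have : L.map ((fun c => c.map fun x => x.1) ∘ tag) = L.map fun c => c := by
        refine List.map_congr_left fun c hc => ?_
        obtain ⟨l₀, l₁, l₂, hc', ht⟩ := tag_eq (hL c hc).1
        simp only [Function.comp_apply, ht]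
        rw [hc']
        simp
      rw [this, List.map_id']
    rw [← h5]
    refine ⟨fun h c hc => ?_, fun h c hc => h c (h1 c hc)⟩
    obtain ⟨d, hd, hdc⟩ := h3 c hc
    obtain ⟨x, hx, hx'⟩ := h d hd
    exact ⟨x, hdc hx, hx'⟩

/-- The context of the search: the advice of the given algorithm, the two thresholds, the index
of the factor graph, and the number of variables. -/
abbrev Ctx : Type := List Bool × ℕ × ℕ × ℕ × ℕ × ℕ

/-- The context for the advice `A`, the degree parameter `d` and `n` variables. -/
def mkCtx (A : List Bool) (d n : ℕ) : Ctx :=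
  (A, d * d, 2 * (d * d) * (d * d), n + 98, slots n d, n)

/-- The initial state of the search. -/
def start (x : List Bool × ℕ × List (List (ℕ × Bool))) :
    List (List (List ((ℕ × Bool) × ℕ))) × Ctx × List Bool :=
  ([distinct (x.2.2.map tag)],
    mkCtx (x.1.drop ((x.1.takeWhile fun b => b).length + 1)) (x.1.takeWhile fun b => b).length x.2.1,
    [])

theorem PT.start : PT start := by
  have h1 : PT fun x : List Bool × ℕ × List (List (ℕ × Bool)) =>
      UFG.distinct (x.2.2.map tag) := by
    apply PT.distinct
    unfold tag
    fun_prop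
  have h2 : PT fun x : List Bool × ℕ × List (List (ℕ × Bool)) =>
      (x.1.takeWhile fun b => b).length := PT.length (PT.takeWhile (by fun_prop))
  unfold UFG.start mkCtx slots
  fun_prop

theorem start_eq (d n : ℕ) (A : List Bool) (L : List (List (ℕ × Bool))) :
    start (List.replicate d true ++ false :: A, n, L) =
      ([distinct (L.map tag)], mkCtx A d n, []) := by
  have h : (List.replicate d true ++ false :: A).takeWhile (fun b => b) = List.replicate d true := by
    induction d with
    | zero => rfl
    | succ d ih => simp [List.replicate_succ]
  simp only [start, h, List.length_replicate]
  congr 3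
  rw [List.drop_append]
  simp

/-- The children of a node of the search tree. -/
def kids (x : Ctx × List (List ((ℕ × Bool) × ℕ))) : List (List (List ((ℕ × Bool) × ℕ))) :=
  children x.1.2.1 x.1.2.2.1 x.2

/-- The input of the given algorithm at a leaf of the search tree. -/
def leafInput (x : Ctx × List (List ((ℕ × Bool) × ℕ))) :
    List Bool × ℕ × List (List (ℕ × Bool)) :=
  (x.1.1, graphVars x.1.2.2.2.1 x.1.2.2.2.2.1, instClauses x.1.2.2.2.1 x.1.2.2.2.2.1
    (x.2.map fun c => c.map fun y => y.1))

theorem PT.kids : PT kids := PT.children (by fun_prop) (by fun_prop) (by fun_prop)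

theorem PT.leafInput : PT leafInput :=
  PT.prodMk (by fun_prop) (PT.prodMk (PT.graphVars (by fun_prop) (by fun_prop))
    (PT.instClauses (by fun_prop) (by fun_prop) (by fun_prop)))

/-- The part of the reduction which depends on the given algorithm: a program that runs the search
and cuts down the answer to the variables of the formula. -/
theorem exists_reduction (c : Prog) : ∃ (r : Prog) (q₁ q₂ q₃ : Polynomial ℕ),
    (∀ (d n : ℕ) (A : List Bool) (L : List (List (ℕ × Bool))),
      sz (mkCtx A d n) ≤ q₁.eval (sz (List.replicate d true ++ false :: A, n, L))) ∧
    ∀ (d n : ℕ) (A : List Bool) (L : List (List (ℕ × Bool)))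
    (Inv P : List (List ((ℕ × Bool) × ℕ)) → Prop) (pot : List (List ((ℕ × Bool) × ℕ)) → ℕ)
    (Ans : List Bool → Prop) (Δ B T l p : ℕ) (x : ℝ),
    1 ≤ x → x ^ (Δ - 1) + x ^ 0 ≤ x ^ Δ → 1 ≤ Δ →
    (∀ S, Inv S → q₂.eval (sz (mkCtx A d n, S)) ≤ B) →
    (∀ S, Inv S → kids (mkCtx A d n, S) = [] ∨ ∃ S₁ S₂, kids (mkCtx A d n, S) = [S₁, S₂] ∧
      Inv S₁ ∧ Inv S₂ ∧ pot S₁ + 1 ≤ pot S ∧ pot S₂ + Δ ≤ pot S ∧ (P S ↔ P S₁ ∨ P S₂)) →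
    (∀ S, Inv S → kids (mkCtx A d n, S) = [] →
      ∃ y, Within c (enc (leafInput (mkCtx A d n, S))) y T ∧
        ((¬ P S ∧ y = .nil) ∨ (P S ∧ ∃ bs, Ans bs ∧ y = enc (0, bs)))) →
    Inv (distinct (L.map tag)) → pot (distinct (L.map tag)) ≤ p →
    (∀ bs, Ans bs → bs.length ≤ l) →
    ∃ (y : Dat) (t : ℕ), Within r (enc (List.replicate d true ++ false :: A, n, L)) y
        (q₁.eval (sz (List.replicate d true ++ false :: A, n, L)) + t + q₃.eval (n + l)) ∧
      (t : ℝ) ≤ 2 * x ^ p * (B + T : ℕ) ∧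
      ((¬ P (distinct (L.map tag)) ∧ y = .nil) ∨
        (P (distinct (L.map tag)) ∧ ∃ bs, Ans bs ∧ y = enc (0, bs.take n))) := by
  obtain ⟨ps, qs, hs⟩ := PT.start
  obtain ⟨W, q, k₀, hW⟩ := exists_search c PT.kids PT.leafInput
  have hpost : PT fun x : ℕ × ℕ × List Bool => ((0 : ℕ), x.2.2.take x.1) := by fun_prop
  obtain ⟨pp, qp, hp⟩ := hpost
  obtain ⟨r₁, k₁, h₁⟩ := exists_cond pp (.assign 0 .nil)
  -- Turns the final state with result `z` into `(z, n, z)`: the first copy is tested, and `n`,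
  -- taken from the context, says where to cut the second.
  let e : Expr := .cons (.tl (.tl (.var 0)))
    (.cons (.tl (.tl (.tl (.tl (.tl (.hd (.tl (.var 0)))))))) (.tl (.tl (.var 0))))
  obtain ⟨r₂, k₂, h₂⟩ := exists_comp (.assign 0 e) r₁
  obtain ⟨r₃, k₃, h₃⟩ := exists_comp W r₂
  obtain ⟨r₄, k₄, h₄⟩ := exists_comp ps r₃
  refine ⟨r₄, qs + Polynomial.C (k₀ + k₁ + k₂ + k₃ + k₄ + 40), q,
    qp.comp (4 * Polynomial.X + 10), ?_, ?_⟩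
  · intro d n A L
    have := (hs (List.replicate d true ++ false :: A, n, L)).2
    rw [start_eq, sz_pair, sz_pair] at this
    simp only [Polynomial.eval_add, Polynomial.eval_C]
    omega
  intro d n A L Inv P pot Ans Δ B T l p x hx hΔ hΔ1 hB hnode hleaf hInv hpot hl
  have hst := hs (List.replicate d true ++ false :: A, n, L)
  rw [start_eq] at hst
  set I := sz (List.replicate d true ++ false :: A, n, L)
  obtain ⟨t, ht, hrun⟩ := search_time (hW (mkCtx A d n)).2.1 (hW (mkCtx A d n)).2.2 hx hΔ hΔ1 hB
    hnode hleaf _ _ hInv rfl [] .nil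
  have ht' : (t : ℝ) ≤ 2 * x ^ p * (B + T : ℕ) := by
    refine ht.trans (mul_le_mul_of_nonneg_right ?_ (Nat.cast_nonneg _))
    have := pow_le_pow_right₀ hx hpot
    linarith
  have hfin : ∀ (z y : Dat) (t₁ : ℕ),
      (z ≠ .nil → Within pp (.cons (enc n) z) y t₁) →
      (z = .nil → Within (.assign 0 .nil) (.cons (enc n) z) y t₁) →
      Within r₂ (enc (([] : List (List (List ((ℕ × Bool) × ℕ)))), mkCtx A d n, z)) y
        (t₁ + (k₁ + k₂ + 20)) := by
    intro z y t₁ hz hz'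
    have := h₂ _ _ _ _ _ (within_expr e
      (enc (([] : List (List (List ((ℕ × Bool) × ℕ)))), mkCtx A d n, z))) (h₁ z _ y t₁ hz hz')
    refine this.mono ?_
    simp only [Expr.cost, e]
    omega
  rcases hrun with ⟨hP, hrun⟩ | ⟨hP, bs, hbs, hrun⟩
  · have e1 := hfin .nil .nil 2 (fun h => absurd rfl h) (fun _ => within_expr .nil _)
    have e2 := h₃ _ _ _ _ _ (hrun _ _ ((hW (mkCtx A d n)).1 .nil)) e1
    refine ⟨.nil, t, (h₄ _ _ _ _ _ hst.1 e2).mono ?_, ht', Or.inl ⟨hP, rfl⟩⟩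
    simp only [Polynomial.eval_add, Polynomial.eval_C]
    omega
  · have e1 := hfin (enc (0, bs)) (enc (0, bs.take n)) (qp.eval (sz (n, 0, bs)))
      (fun _ => (hp (n, 0, bs)).1) (fun h => by simp [enc] at h)
    have e2 := h₃ _ _ _ _ _ (hrun _ _ ((hW (mkCtx A d n)).1 (enc (0, bs)))) e1
    refine ⟨_, t, (h₄ _ _ _ _ _ hst.1 e2).mono ?_, ht', Or.inr ⟨hP, bs, hbs, rfl⟩⟩
    have h5 : qp.eval (sz (n, 0, bs)) ≤ (qp.comp (4 * Polynomial.X + 10)).eval (n + l) := by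
      rw [Polynomial.eval_comp]
      apply evalMono
      have h6 := sz_le_of_forall (l := bs) fun b _ => sz_bool_le b
      have h7 := hl bs hbs
      simp only [sz_pair, sz_nat, Polynomial.eval_add, Polynomial.eval_mul, Polynomial.eval_X,
        Polynomial.eval_ofNat]
      omega
    simp only [Polynomial.eval_add, Polynomial.eval_C]
    omega

/-! ### From the search to an algorithm for all instances -/

theorem Formula.clauses_spec (φ : Formula) :
    ∀ c ∈ φ.clauses, c.length = 3 ∧ ∀ l ∈ c, l.1 < φ.numVars := by
  intro c hc
  obtain ⟨j, rfl⟩ := List.mem_ofFn.1 hc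
  refine ⟨List.length_ofFn, fun l hl => ?_⟩
  obtain ⟨i, rfl⟩ := List.mem_ofFn.1 hl
  exact (φ.lit j i).1.2

theorem Formula.satisfiable_iff (φ : Formula) :
    φ.Satisfiable ↔ ∃ a, Sat (LitTrue a) φ.clauses := by
  constructor
  · rintro ⟨a, ha⟩
    exact ⟨extend a, (φ.satisfiedBy_iff _).1 (by rwa [extend_val])⟩
  · rintro ⟨a, ha⟩
    exact ⟨_, (φ.satisfiedBy_iff a).2 ha⟩

theorem sz_clauses_le (φ : Formula) :
    sz φ.clauses ≤ φ.numClauses * (3 * (2 * φ.numVars + 6) + 2) + 1 := by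
  have h := sz_le_of_forall (l := φ.clauses) (k := 3 * (2 * φ.numVars + 6) + 1) fun c hc => by
    have h1 := φ.clauses_spec c hc
    have := sz_le_of_forall (l := c) (k := 2 * φ.numVars + 5) fun l hl => by
      have := h1.2 l hl
      have := sz_bool_le l.2
      change sz (l.1, l.2) ≤ _
      rw [sz_pair, sz_nat]
      omega
    rwa [h1.1] at this
  simpa [Formula.clauses] using h

theorem Invariant.sz_le {n m D : ℕ} {S : List (List ((ℕ × Bool) × ℕ))}
    (hS : Invariant (items n) D S) (hm : S.length ≤ m) :
    sz S ≤ m * (3 * (2 * n + 12) + 2) + 1 := by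
  have h := sz_le_of_forall (l := S) (k := 3 * (2 * n + 12) + 1) fun c hc => by
    have h1 := sz_le_of_forall (l := c) (k := 2 * n + 11) fun x hx => by
      have h2 := hS.clutter.mem c hc x hx
      simp only [items, Finset.mem_product, Finset.mem_range, Finset.mem_univ, and_true] at h2
      have := sz_bool_le x.1.2
      change sz ((x.1.1, x.1.2), x.2) ≤ _
      rw [sz_pair, sz_pair, sz_nat, sz_nat]
      omega
    have := Nat.mul_le_mul_right (2 * n + 11 + 1) (hS.clutter.le_three c hc)
    omega
  have := Nat.mul_le_mul_right (3 * (2 * n + 12) + 1 + 1) hm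
  exact h.trans (Nat.succ_le_succ this)

theorem sat_children {S : List (List ((ℕ × Bool) × ℕ))} (a : ℕ → Bool) (k : ℕ)
    (H : List ((ℕ × Bool) × ℕ)) : Sat (ItemTrue a) S ↔
      Sat (ItemTrue a) (addAll [H] S) ∨ Sat (ItemTrue a) (addAll (petals S k H) S) := by
  rw [sat_addAll, sat_addAll]
  constructor
  · intro h
    exact (sat_heart_or_petals h k H).imp (fun h' => ⟨h', h⟩) (fun h' => ⟨h', h⟩)
  · rintro (h | h)
    exacts [h.2, h.2]

/-- What is maintained during the search for a formula with `n` variables, `m` clauses and the list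
of clauses `L`. -/
structure Node (n m D : ℕ) (L : List (List (ℕ × Bool))) (S : List (List ((ℕ × Bool) × ℕ))) :
    Prop where
  inv : Invariant (items n) D S
  length_le : S.length ≤ m
  sat : ∀ a, Sat (ItemTrue a) S → Sat (LitTrue a) L

theorem kids_mkCtx (A : List Bool) (d n : ℕ) (S : List (List ((ℕ × Bool) × ℕ))) :
    kids (mkCtx A d n, S) = children (d * d) (2 * (d * d) * (d * d)) S := rfl

theorem flowers_eq_nil_of_children {D D' : ℕ} {S : List (List ((ℕ × Bool) × ℕ))}
    (h : children D D' S = []) : flowers D D' S = [] := by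
  cases hf : flowers D D' S with
  | nil => rfl
  | cons f l => simp [children, hf, headL] at h

/-- The potential is the progress still possible. Both children obey `progress_le` with `6n` items,
so the truncated subtractions lose nothing. -/
theorem Node.step {n m d : ℕ} (hd : 0 < d) {L : List (List (ℕ × Bool))}
    {S : List (List ((ℕ × Bool) × ℕ))} (hS : Node n m (d * d) L S) (A : List Bool) :
    kids (mkCtx A d n, S) = [] ∨ ∃ S₁ S₂, kids (mkCtx A d n, S) = [S₁, S₂] ∧
      Node n m (d * d) L S₁ ∧ Node n m (d * d) L S₂ ∧
      (36 * n * (d * d) - progress (d * d) S₁) + 1 ≤ 36 * n * (d * d) - progress (d * d) S ∧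
      (36 * n * (d * d) - progress (d * d) S₂) + 2 * (d * d) * (d * d) ≤
        36 * n * (d * d) - progress (d * d) S ∧
      ((∃ a, Sat (ItemTrue a) S) ↔ (∃ a, Sat (ItemTrue a) S₁) ∨ ∃ a, Sat (ItemTrue a) S₂) := by
  rw [kids_mkCtx]
  cases hf : flowers (d * d) (2 * (d * d) * (d * d)) S with
  | nil => left; simp [children, hf, headL]
  | cons f l =>
    obtain ⟨k, H⟩ := f
    right
    have hD : 0 < d * d := Nat.mul_pos hd hd
    obtain ⟨⟨i1, l1, p1⟩, ⟨i2, l2, p2⟩⟩ := children_spec hD hS.inv hf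
    have b1 := progress_le i1
    have b2 := progress_le i2
    rw [card_items] at b1 b2
    have hb : 6 * (d * d) * (6 * n) = 36 * n * (d * d) := by ring
    rw [hb] at b1 b2
    refine ⟨addAll [H] S, addAll (petals S k H) S, by simp [children, hf, headL],
      ⟨i1, l1.trans hS.length_le, fun a h => hS.sat a ((sat_children a k H).2 (Or.inl h))⟩,
      ⟨i2, l2.trans hS.length_le, fun a h => hS.sat a ((sat_children a k H).2 (Or.inr h))⟩,
      by omega, by omega, ?_⟩
    rw [← exists_or]
    exact exists_congr fun a => sat_children a k H

theorem sat_inst_of_node {n m d : ℕ} {L : List (List (ℕ × Bool))}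
    {S : List (List ((ℕ × Bool) × ℕ))} (hS : Node n m (d * d) L S) (a : ℕ → Bool) {n' m' : ℕ}
    (hn : n ≤ n') (hm : S.length ≤ m')
    (h : Sat (LitTrue a) (instClauses n' m' (S.map fun c => c.map fun x => x.1))) :
    Sat (ItemTrue a) S := by
  rw [← sat_untag]
  refine sat_of_sat_instClauses h (by simpa using hm) ?_ ?_
  · intro c hc
    obtain ⟨d, hd, rfl⟩ := List.mem_map.1 hc
    have := hS.inv.clutter.pos d hd
    rw [ne_eq, List.map_eq_nil_iff]
    rintro rfl
    simp at this
  · intro c hc l hl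
    obtain ⟨d, hd, rfl⟩ := List.mem_map.1 hc
    obtain ⟨x, hx, rfl⟩ := List.mem_map.1 hl
    have h2 := hS.inv.clutter.mem d hd x hx
    simp only [items, Finset.mem_product, Finset.mem_range, Finset.mem_univ, and_true] at h2
    omega

theorem exists_sat_inst_of_node {n m d : ℕ} {L : List (List (ℕ × Bool))}
    {S : List (List ((ℕ × Bool) × ℕ))} (hS : Node n m (d * d) L S) {a : ℕ → Bool} (n' m' : ℕ)
    (h : Sat (ItemTrue a) S) :
    ∃ b, Sat (LitTrue b) (instClauses n' m' (S.map fun c => c.map fun x => x.1)) := by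
  rw [← sat_untag] at h
  refine exists_sat_instClauses h fun c hc => ?_
  obtain ⟨d, hd, rfl⟩ := List.mem_map.1 hc
  rw [List.length_map]
  exact hS.inv.clutter.le_three d hd

theorem slots_degParam_le {ε : ℝ} (hε1 : ε ≤ 1) {n : ℕ} (hn : 0 < n) :
    slots n (degParam ε n) ≤ 24 * n ^ 5 := by
  have h := Nat.pow_le_pow_left (degParam_le hε1 hn) 4
  calc slots n (degParam ε n) = 24 * n * (degParam ε n) ^ 4 := by rw [slots]; ring
    _ ≤ 24 * n * n ^ 4 := Nat.mul_le_mul_left _ h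
    _ = 24 * n ^ 5 := by ring

/-- The reduction of all instances to those on the universal graphs. The correct answers to a
task are given by the relation `R` between satisfiable formulas and strings. -/
theorem subexpPolySolvable_of_family {task : Task} {R : Formula → List Bool → Prop}
    (htask : ∀ φ y, task φ y ↔
      (∃ bs, R φ bs ∧ y = enc ((0 : ℕ), bs)) ∨ (¬ φ.Satisfiable ∧ y = .nil))
    (hsat : ∀ φ bs, R φ bs → φ.Satisfiable)
    (hlen : ∀ φ bs, R φ bs → bs.length ≤ φ.numVars)
    (htake : ∀ φ ψ bs, φ.numVars ≤ ψ.numVars →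
      (∀ a, Sat (LitTrue a) ψ.clauses → Sat (LitTrue a) φ.clauses) → R ψ bs →
        R φ (bs.take φ.numVars))
    (h : SubexpPolySolvable task (familyInstances universalGraph)) :
    SubexpPolySolvable task allInstances := by
  obtain ⟨c, adv, p, ε₀, C, hε₀, hc⟩ := h
  obtain ⟨ε, hε, hε1, hεε⟩ : ∃ ε : ℝ, 0 < ε ∧ ε ≤ 1 ∧ ε ≤ ε₀ :=
    ⟨min ε₀ 1, lt_min hε₀ one_pos, min_le_right _ _, min_le_left _ _⟩
  obtain ⟨r, q₁, q₂, q₃, hctx, hr⟩ := exists_reduction c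
  let A : ℕ → List Bool := fun n => adv (n + 98) (slots n (degParam ε n))
  -- the length of the advice
  obtain ⟨QA, hQA⟩ : ∃ Q : Polynomial ℕ, ∀ n, 0 < n → (A n).length ≤ Q.eval n := by
    refine ⟨p.comp ((Polynomial.X + 98 + 3 * (24 * Polynomial.X ^ 5) + 3) +
      (4 + 24 * Polynomial.X ^ 5 * (1 + 3 * (Polynomial.X + 98)))), fun n hn => ?_⟩
    -- The bound on the advice is available only through an instance; the empty list of clauses
    -- supplies one.
    obtain ⟨pol, hpol⟩ := exists_inst (n + 98) (slots n (degParam ε n)) []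
    refine (hc _ _ _ ⟨isIndex_slots hε hε1 hn, pol, rfl⟩).1.trans ?_
    rw [Polynomial.eval_comp]
    apply evalMono
    have h1 : ((universalGraph (n + 98) (slots n (degParam ε n))).inst pol).numVars =
      n + 98 + 3 * slots n (degParam ε n) + 3 := by
        simp only [FactorGraph.inst, universalGraph, graphVars]; ring
    have h2 : ((universalGraph (n + 98) (slots n (degParam ε n))).inst pol).numClauses =
        4 + slots n (degParam ε n) * (1 + 3 * (n + 98)) := by
      rw [← length_instClauses _ _ [], ← hpol]
      simp [Formula.clauses]
    have h3 := slots_degParam_le hε1 hn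
    have h4 := Nat.mul_le_mul_right (1 + 3 * (n + 98)) h3
    rw [h1, h2]
    simp only [Polynomial.eval_add, Polynomial.eval_mul, Polynomial.eval_X, Polynomial.eval_pow,
      Polynomial.eval_ofNat, Polynomial.eval_one]
    omega
  -- the size of the input
  let QI : Polynomial ℕ := (Polynomial.X + 1 + QA) * 4 + 1 + (2 * Polynomial.X + 1 +
    (8 * Polynomial.X ^ 3 * (3 * (2 * Polynomial.X + 6) + 2) + 1) + 1) + 1
  -- the time spent at a node of the search tree
  let QB : Polynomial ℕ := q₂.comp (q₁.comp QI +
    (8 * Polynomial.X ^ 3 * (3 * (2 * Polynomial.X + 12) + 2) + 1) + 1)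
  let N : ℕ → ℕ := fun n => graphVars (n + 98) (slots n (degParam ε n))
  let QN : Polynomial ℕ := Polynomial.X + 98 + 3 * (24 * Polynomial.X ^ 5) + 3
  have hN : ∀ n, 0 < n → N n ≤ QN.eval n := fun n hn => by
    have h3 := slots_degParam_le hε1 hn
    simp only [N, QN, graphVars, Polynomial.eval_add, Polynomial.eval_mul, Polynomial.eval_X,
      Polynomial.eval_pow, Polynomial.eval_ofNat]
    omega
  -- Dominates both `1 - ε / 4`, from the tree, and `1 - ε ^ 2`, from the solver, as `ε ≤ 1`; being
  -- positive, it also absorbs polynomial factors.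
  let β : ℝ := 1 - ε ^ 2 / 4
  have hβ : 0 < β := by simp only [β]; nlinarith
  have e1 : ExpBounded β fun n =>
      (1 + 1 / (degParam ε n : ℝ) ^ 3) ^ (36 * n * (degParam ε n * degParam ε n)) :=
    (expBounded_tree hε).mono_exponent (by simp only [β]; nlinarith)
  have e2 : ExpBounded β fun n => (2 : ℝ) ^ (C * (N n : ℝ) ^ (1 - ε₀)) :=
    (expBounded_solver hε hε1 hεε C).mono_exponent (by simp only [β]; nlinarith)
  have e3 := (((ExpBounded.eval hβ (q₁.comp QI)).add hβ.le
    ((((ExpBounded.const hβ.le 2).mul e1 (fun _ => by norm_num)).mul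
      ((ExpBounded.eval hβ QB).add hβ.le e2) (fun n => by positivity)))).add hβ.le
        (ExpBounded.eval hβ (q₃.comp (Polynomial.X + QN))))
  obtain ⟨C', -, hC'⟩ := e3
  refine ⟨r, fun n _ => List.replicate (degParam ε n) true ++ false :: A n,
    Polynomial.X + 1 + QA, ε ^ 2 / 4, C', by positivity, ?_⟩
  rintro n m φ ⟨rfl, rfl, hn, hm, hmn⟩
  set n := φ.numVars with hnφ
  set m := φ.numClauses with hmφ
  set d := degParam ε n with hd
  have hd0 : 1 ≤ d := one_le_degParam hε hn
  have hdn : d ≤ n := degParam_le hε1 hn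
  have hAn := hQA n hn
  have hAlen : (List.replicate d true ++ false :: A n).length ≤ n + 1 + QA.eval n := by
    simp only [List.length_append, List.length_replicate, List.length_cons]
    omega
  refine ⟨hAlen.trans ?_, ?_⟩
  · have := evalMono QA (Nat.le_add_right n m)
    simp only [Polynomial.eval_add, Polynomial.eval_X, Polynomial.eval_one]
    omega
  have hm3 : m ≤ 8 * n ^ 3 := hmn.trans_eq (by ring)
  have hI : sz (List.replicate d true ++ false :: A n, n, φ.clauses) ≤ QI.eval n := by
    have h1 := sz_le_of_forall (l := List.replicate d true ++ false :: A n) fun b _ => sz_bool_le b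
    have h2 : sz φ.clauses ≤ m * (3 * (2 * n + 6) + 2) + 1 := sz_clauses_le φ
    have h3 := Nat.mul_le_mul_right (3 * (2 * n + 6) + 2) hm3
    simp only [QI, sz_pair, sz_nat, Polynomial.eval_add, Polynomial.eval_mul, Polynomial.eval_X,
      Polynomial.eval_pow, Polynomial.eval_ofNat, Polynomial.eval_one]
    omega
  have hcls := start_spec φ.clauses_spec (d * d)
  have hlenφ : φ.clauses.length = m := by simp [Formula.clauses, hmφ]
  have hx : (1 : ℝ) ≤ 1 + 1 / (d : ℝ) ^ 3 := le_add_of_nonneg_right (by positivity)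
  let ψ := fun pol => (universalGraph (n + 98) (slots n d)).inst pol
  -- A leaf answers for a formula with `N n` variables, so an answer counts as correct if its first
  -- `n` bits answer `φ`. Rounding down makes the real time bound of the solver a number of steps.
  obtain ⟨y, t, hy, ht, hres⟩ := hr d n (A n) φ.clauses (Node n m (d * d) φ.clauses)
    (fun S => ∃ a, Sat (ItemTrue a) S) (fun S => 36 * n * (d * d) - progress (d * d) S)
    (fun bs => R φ (bs.take n) ∧ bs.length ≤ N n) (2 * (d * d) * (d * d)) (QB.eval n)
    ⌊(2 : ℝ) ^ (C * (N n : ℝ) ^ (1 - ε₀))⌋₊ (N n) (36 * n * (d * d)) (1 + 1 / (d : ℝ) ^ 3)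
    hx (branching_inequality hd0) (Nat.one_le_iff_ne_zero.2 (by positivity))
    (fun S hS => by
      have h1 := (hctx d n (A n) φ.clauses).trans (evalMono q₁ hI)
      have h2 := hS.inv.sz_le hS.length_le
      have h3 := Nat.mul_le_mul_right (3 * (2 * n + 12) + 2) hm3
      simp only [QB, Polynomial.eval_comp]
      apply evalMono
      simp only [sz_pair, Polynomial.eval_add, Polynomial.eval_mul, Polynomial.eval_X,
        Polynomial.eval_pow, Polynomial.eval_ofNat, Polynomial.eval_one, Polynomial.eval_comp]
      omega) (fun S hS => hS.step hd0 (A n))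
    (by
      intro S hS hkids
      have hfl := flowers_eq_nil_of_children hkids
      have hle := length_le_of_flowers_eq_nil (by positivity) hS.inv hfl
      rw [card_items] at hle
      have hlen' : S.length ≤ slots n d := hle.trans_eq (by rw [slots]; ring)
      obtain ⟨pol, hpol⟩ := exists_inst (n + 98) (slots n d) (S.map fun c => c.map fun x => x.1)
      obtain ⟨-, y, t, hcomp, hyt, ht⟩ := hc (n + 98) (slots n d) (ψ pol)
        ⟨isIndex_slots hε hε1 hn, pol, rfl⟩
      have hsat' : ∀ a, Sat (LitTrue a) (ψ pol).clauses → Sat (ItemTrue a) S := fun a ha => by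
        rw [hpol] at ha
        exact sat_inst_of_node hS a (by omega) hlen' ha
      refine ⟨y, ⟨t, Nat.le_floor ht, ?_⟩, ?_⟩
      · rw [Formula.encode_eq, hpol] at hcomp
        exact hcomp
      · rcases (htask _ _).1 hyt with ⟨bs, hbs, rfl⟩ | ⟨hns, rfl⟩
        · refine Or.inr ⟨?_, bs, ⟨?_, hlen _ _ hbs⟩, rfl⟩
          · obtain ⟨a, ha⟩ := ((ψ pol).satisfiable_iff).1 (hsat _ _ hbs)
            exact ⟨a, hsat' a ha⟩
          · exact htake φ (ψ pol) bs (by simp only [ψ, FactorGraph.inst, universalGraph, graphVars]; omega)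
              (fun a ha => hS.sat a (hsat' a ha)) hbs
        · refine Or.inl ⟨?_, rfl⟩
          rintro ⟨a, ha⟩
          obtain ⟨b, hb⟩ := exists_sat_inst_of_node hS (n + 98) (slots n d) ha
          exact hns (((ψ pol).satisfiable_iff).2 ⟨b, by rwa [hpol]⟩))
    ⟨hcls.1, hlenφ ▸ hcls.2.1, fun a => (hcls.2.2 a).1⟩ (Nat.sub_le _ _) (fun bs h => h.2)
  obtain ⟨t', ht', hcomp⟩ := hy
  refine ⟨y, t', ?_, ?_, ?_⟩
  · rw [Formula.encode_eq]
    exact hcomp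
  · rw [htask]
    simp only [hcls.2.2, ← φ.satisfiable_iff] at hres
    rcases hres with ⟨h1, h2⟩ | ⟨-, bs, h1, h2⟩
    · exact Or.inr ⟨h1, h2⟩
    · exact Or.inl ⟨_, h1.1, h2⟩
  · refine le_trans ?_ (hC' n hn)
    have h1 := evalMono q₁ hI
    have h2 : q₃.eval (n + N n) ≤ q₃.eval (n + QN.eval n) :=
      evalMono q₃ (Nat.add_le_add_left (hN n hn) n)
    have h3 : (t' : ℝ) ≤ (q₁.eval (QI.eval n) : ℕ) + t + (q₃.eval (n + QN.eval n) : ℕ) := by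
      exact_mod_cast ht'.trans (Nat.add_le_add (Nat.add_le_add_right h1 t) h2)
    have h4 : ((QB.eval n + ⌊(2 : ℝ) ^ (C * (N n : ℝ) ^ (1 - ε₀))⌋₊ : ℕ) : ℝ) ≤
        (QB.eval n : ℕ) + (2 : ℝ) ^ (C * (N n : ℝ) ^ (1 - ε₀)) := by
      rw [Nat.cast_add]
      exact add_le_add_right (Nat.floor_le (by positivity)) _
    have h5 := ht.trans (mul_le_mul_of_nonneg_left h4 (by positivity))
    simp only [Polynomial.eval_comp, Polynomial.eval_add, Polynomial.eval_X]
    linarith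

/-! ### The decision task and the search task -/

/-- The correct answers to the decision task. -/
theorem decisionTask_iff (φ : Formula) (y : Dat) : decisionTask φ y ↔
    (∃ bs : List Bool, (φ.Satisfiable ∧ bs = []) ∧ y = enc ((0 : ℕ), bs)) ∨
      (¬ φ.Satisfiable ∧ y = .nil) := by
  -- The tree for `true` is also the encoding of zero paired with the empty list.
  refine or_congr ⟨fun h => ⟨[], ⟨h.1, rfl⟩, h.2⟩, ?_⟩ Iff.rfl
  rintro ⟨bs, ⟨h, rfl⟩, rfl⟩
  exact ⟨h, rfl⟩

/-- The correct answers to the search task. -/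
theorem searchTask_iff (φ : Formula) (y : Dat) : searchTask φ y ↔
    (∃ bs : List Bool, (∃ a, φ.SatisfiedBy a ∧ bs = List.ofFn a) ∧ y = enc ((0 : ℕ), bs)) ∨
      (¬ φ.Satisfiable ∧ y = .nil) := by
  have h : ∀ a : Fin φ.numVars → Bool, enc ((0 : ℕ), List.ofFn a) =
      .cons .nil (encodeAssignment a) := fun a => by
    simp only [enc, encodeAssignment, List.map_ofFn]
    rfl
  refine or_congr ⟨?_, ?_⟩ Iff.rfl
  · rintro ⟨a, ha, rfl⟩
    exact ⟨_, ⟨a, ha, rfl⟩, (h a).symm⟩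
  · rintro ⟨_, ⟨a, ha, rfl⟩, rfl⟩
    exact ⟨a, ha, h a⟩

theorem isSubexpUniversal_decisionTask : IsSubexpUniversal decisionTask universalGraph := by
  refine ⟨isUniformFamily_universalGraph, subexpPolySolvable_of_family decisionTask_iff
    (fun _ _ h => h.1) (fun _ _ h => by simp [h.2]) ?_⟩
  rintro φ ψ bs - h ⟨hψ, rfl⟩
  obtain ⟨a, ha⟩ := ψ.satisfiable_iff.1 hψ
  exact ⟨φ.satisfiable_iff.2 ⟨a, h a ha⟩, by simp⟩

theorem isSubexpUniversal_searchTask : IsSubexpUniversal searchTask universalGraph := by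
  refine ⟨isUniformFamily_universalGraph, subexpPolySolvable_of_family searchTask_iff
    (fun _ _ h => ⟨h.choose, h.choose_spec.1⟩) ?_ ?_⟩
  · rintro φ _ ⟨a, -, rfl⟩
    simp
  · rintro φ ψ _ hle h ⟨a, ha, rfl⟩
    have h1 : Sat (LitTrue (extend a)) ψ.clauses :=
      (ψ.satisfiedBy_iff _).1 (by rwa [extend_val])
    refine ⟨fun v => extend a v, (φ.satisfiedBy_iff _).2 (h _ h1), ?_⟩
    apply List.ext_getElem
    · simpa using hle
    · intro i h2 h3
      have h4 : i < ψ.numVars := by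
        simp only [List.length_ofFn] at h3
        omega
      simp [extend, h4]

end UFG

/-- There are subexp-universal factor graphs for 3SAT, both for deciding satisfiability and for
finding satisfying assignments. -/
theorem theorem2 :
    ∃ F : ℕ → ℕ → UFG.FactorGraph,
      UFG.IsSubexpUniversal UFG.decisionTask F ∧ UFG.IsSubexpUniversal UFG.searchTask F :=
  ⟨UFG.universalGraph, UFG.isSubexpUniversal_decisionTask, UFG.isSubexpUniversal_searchTask⟩
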